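/- Let $G=\widetilde{\mathrm{PSL}}(2,\mathbb{R})$ be the universal covering group of $\mathrm{PSL}(2,\mathbb{R})=\mathrm{SL}(2,\mathbb{R})/\{\pm I\}$, acting isometrically on the hyperbolic plane $\mathbb{H}^2$ through the projection $\theta:G\to\mathrm{PSL}(2,\mathbb{R})$, and for $P\in G$ let $$L(P)=\inf_{z\in\mathbb{H}^2} d_{\mathbb{H}^2}(z,Pz)$$ be its translation length. Let $\{X^t\}_{t\in\mathbb{R}}$ be the one-parameter subgroup of $G$ with $\theta(X^t)=\begin{bmatrix} e^{t/2}&0\\0&e^{-t/2}\end{bmatrix}$. Let $\Gamma\subset G$ be a cocompact lattice, i.e. a discrete subgroup such that the closed three-manifold $M_\Gamma=\Gamma\backslash G$ is compact, and let $X_\Gamma$ be the vector field on $M_\Gamma$ generating the flow $\Gamma P\mapsto \Gamma P X^t$. Identify $\Gamma$ with the fundamental group of $M_\Gamma$; for a de Rham class $a\in H^1(M_\Gamma,\mathbb{R})$ and $\gamma\in\Gamma$, let $a(\gamma)$ be the integral of a closed one-form representing $a$ along a loop representing $\gamma$. Let $\Delta_\Gamma$ be the set of classes $a\in H^1(M_\Gamma,\mathbb{R})$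 such that $$\sup\left\{\frac{|a(\gamma)|}{L(\gamma)}\;\middle|\;\gamma\in\Gamma,\ L(\gamma)\neq 0\right\}<1.$$ Then: (i) $\Delta_\Gamma$ is a non-empty, open and convex subset of the finite-dimensional real vector space $H^1(M_\Gamma,\mathbb{R})$; (ii) a class $a\in H^1(M_\Gamma,\mathbb{R})$ belongs to $\Delta_\Gamma$ if and only if it is represented by a smooth closed one-form $\omega$ on $M_\Gamma$ with $$\inf_{p\in M_\Gamma}\omega(X_\Gamma)(p)>-1.$$ -/

import Mathlib

open Topology
open scoped Manifold ContDiff MatrixGroups UpperHalfPlane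

/-- The universal covering group of `PSL(2, ℝ)` (equivalently, of `SL(2, ℝ)`). An element is a matrix
`A = (a, b; c, d)` in `SL(2, ℝ)` together with a continuous branch over the upper half plane of the
logarithm of the automorphy factor `c z + d`. That this is the universal covering group is
verified below: it is simply connected, it is a Lie group, and the projection `toPSL` is a group
homomorphism which is a covering map onto `PSL(2, ℝ)`. -/
@[ext]
structure PSLTilde where
  mat : SL(2, ℝ)
  log : ℍ → ℂ
  continuous_log : Continuous log
  exp_log : ∀ z : ℍ, Complex.exp (log z) = (mat 1 0 : ℂ) * z + (mat 1 1 : ℂ)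

namespace PSLTilde

lemma cocycle (A B : SL(2, ℝ)) (z : ℍ) :
    (((A * B) 1 0 : ℝ) : ℂ) * z + ((A * B) 1 1 : ℝ) =
      ((A 1 0 : ℂ) * ((B • z : ℍ) : ℂ) + A 1 1) * ((B 1 0 : ℂ) * z + B 1 1) := by
  have h := UpperHalfPlane.denom_ne_zero (B : GL (Fin 2) ℝ) z
  simp only [UpperHalfPlane.denom, Matrix.SpecialLinearGroup.coe_GL_coe_matrix] at h
  rw [UpperHalfPlane.coe_specialLinearGroup_apply]
  simp [Matrix.mul_apply, Fin.sum_univ_two] at h ⊢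
  field_simp
  ring

/-- The product is `(A, u) (B, v) = (A B, z ↦ u (B z) + v z)`. -/
noncomputable instance : Group PSLTilde where
  mul g h :=
    { mat := g.mat * h.mat
      log := fun z => g.log (h.mat • z) + h.log z
      continuous_log := by
        have := g.continuous_log
        have := h.continuous_log
        have : Continuous fun z : ℍ => h.mat • z :=
          continuous_const_smul (h.mat : GL (Fin 2) ℝ)
        fun_prop
      exp_log := fun z => by
        rw [Complex.exp_add, g.exp_log, h.exp_log, cocycle] }
  one :=
    { mat := 1
      log := fun _ => 0
      continuous_log := continuous_const
      exp_log := fun z => by simp }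
  inv g :=
    { mat := g.mat⁻¹
      log := fun z => - g.log (g.mat⁻¹ • z)
      continuous_log := by
        have := g.continuous_log
        have : Continuous fun z : ℍ => g.mat⁻¹ • z :=
          continuous_const_smul (g.mat⁻¹ : GL (Fin 2) ℝ)
        fun_prop
      exp_log := fun z => by
        rw [Complex.exp_neg, g.exp_log]
        refine (eq_inv_of_mul_eq_one_right ?_).symm
        rw [← cocycle]
        simp }
  mul_assoc g h k := by
    refine PSLTilde.ext (mul_assoc _ _ _) (funext fun z => ?_)
    change (g.log (h.mat • k.mat • z) + h.log (k.mat • z)) + k.log z =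
      g.log ((h.mat * k.mat) • z) + (h.log (k.mat • z) + k.log z)
    rw [mul_smul, add_assoc]
  one_mul g := by
    refine PSLTilde.ext (one_mul _) (funext fun z => ?_)
    exact zero_add _
  mul_one g := by
    refine PSLTilde.ext (mul_one _) (funext fun z => ?_)
    change g.log ((1 : SL(2, ℝ)) • z) + 0 = g.log z
    rw [one_smul, add_zero]
  inv_mul_cancel g := by
    refine PSLTilde.ext (inv_mul_cancel _) (funext fun z => ?_)
    change - g.log (g.mat⁻¹ • g.mat • z) + g.log z = 0
    rw [inv_smul_smul, neg_add_cancel]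

@[simp] lemma mul_mat (g h : PSLTilde) : (g * h).mat = g.mat * h.mat := rfl
@[simp] lemma mul_log (g h : PSLTilde) (z : ℍ) :
    (g * h).log z = g.log (h.mat • z) + h.log z := rfl
@[simp] lemma one_mat : (1 : PSLTilde).mat = 1 := rfl
@[simp] lemma inv_mat (g : PSLTilde) : g⁻¹.mat = g.mat⁻¹ := rfl
@[simp] lemma inv_log (g : PSLTilde) (z : ℍ) : g⁻¹.log z = - g.log (g.mat⁻¹ • z) := rfl

/-- The topology of the pull-back of the covering `exp : ℂ → ℂ \ {0}` by
`SL(2, ℝ) → ℂ \ {0}`, `A ↦ c i + d`. -/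
noncomputable instance : TopologicalSpace PSLTilde :=
  .induced (fun g => (g.mat, g.log UpperHalfPlane.I)) inferInstance

/-- The quotient `(c z + d) / (c i + d)`. -/
noncomputable def ratio (c d : ℝ) (z : ℂ) : ℂ := ((c : ℂ) * z + d) / ((c : ℂ) * Complex.I + d)

lemma ratio_mem_slitPlane {c d : ℝ} (h : c ≠ 0 ∨ d ≠ 0) {z : ℂ} (hz : 0 < z.im) :
    ratio c d z ∈ Complex.slitPlane := by
  have hn : 0 < d ^ 2 + c ^ 2 := by
    rcases h with h | h <;> positivity
  have e : ratio c d z = ((c * (c * z.im) + d * (c * z.re + d)) / (d ^ 2 + c ^ 2) : ℝ)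
      + ((d * (c * z.im) - c * (c * z.re + d)) / (d ^ 2 + c ^ 2) : ℝ) * Complex.I := by
    have h0 : (c : ℂ) * Complex.I + d ≠ 0 := by
      intro h0
      have h1 := congrArg Complex.re h0
      have h2 := congrArg Complex.im h0
      simp at h1 h2
      simp [h1, h2] at h
    have hn' : (d : ℂ) ^ 2 + (c : ℂ) ^ 2 ≠ 0 := by exact_mod_cast hn.ne'
    rw [ratio]
    conv_lhs => rw [← Complex.re_add_im z]
    push_cast
    field_simp
    linear_combination ((c : ℂ) ^ 2 * d + c ^ 3 * z.re - c ^ 2 * z.im * d) * Complex.I_sq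
  rw [Complex.mem_slitPlane_iff, e]
  simp only [Complex.add_re, Complex.ofReal_re, Complex.re_ofReal_mul, Complex.I_re, mul_zero,
    add_zero, Complex.add_im, Complex.ofReal_im, Complex.im_ofReal_mul, Complex.I_im, mul_one,
    zero_add]
  by_contra! hcon
  obtain ⟨h1, h2⟩ := hcon
  rw [div_eq_zero_iff, or_iff_left hn.ne'] at h2
  rw [div_le_iff₀ hn, zero_mul] at h1
  by_cases hc : c = 0
  · subst hc
    have hd : d ≠ 0 := by simpa using h
    have : 0 < d ^ 2 := by positivity
    nlinarith
  · have : c * z.re + d = d * z.im := by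
      have : c * (d * z.im - (c * z.re + d)) = 0 := by linarith
      rcases mul_eq_zero.1 this with h | h
      · exact absurd h hc
      · linarith
    rw [this] at h1
    nlinarith [mul_pos hn hz]

lemma cd_ne_zero (A : SL(2, ℝ)) : A 1 0 ≠ 0 ∨ A 1 1 ≠ 0 := by
  by_contra! h
  have := A.det_coe
  rw [Matrix.det_fin_two] at this
  simp [h.1, h.2] at this

lemma eq_of_exp_eq {u v : ℍ → ℂ} (hu : Continuous u) (hv : Continuous v)
    (h : ∀ z, Complex.exp (u z) = Complex.exp (v z)) {z₀ : ℍ} (h0 : u z₀ = v z₀) : u = v := by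
  choose n hn using fun z => Complex.exp_eq_exp_iff_exists_int.1 (h z)
  have hn' : ∀ z, ((n z : ℝ)) = (u z - v z).im / (2 * Real.pi) := fun z => by
    have : u z - v z = ((n z * (2 * Real.pi) : ℝ) : ℂ) * Complex.I := by
      rw [hn z]; push_cast; ring
    rw [this, Complex.im_ofReal_mul, Complex.I_im]
    field_simp
  have hc : Continuous n := by
    rw [Int.isClosedEmbedding_coe_real.isInducing.continuous_iff]
    have : (Int.cast ∘ n : ℍ → ℝ) = fun z => (u z - v z).im / (2 * Real.pi) := funext hn'
    rw [this]
    fun_prop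
  funext z
  have h1 : n z = n z₀ := PreconnectedSpace.constant inferInstance hc
  have h2 : n z₀ = 0 := by
    have := hn' z₀
    rw [h0, sub_self] at this
    simpa using this
  rw [hn z, h1, h2]
  simp

lemma ratio_eq (A : SL(2, ℝ)) (z : ℂ) :
    ratio (A 1 0) (A 1 1) z * ((A 1 0 : ℂ) * Complex.I + A 1 1) = (A 1 0 : ℂ) * z + A 1 1 := by
  have := UpperHalfPlane.denom_ne_zero (A : GL (Fin 2) ℝ) UpperHalfPlane.I
  simp only [UpperHalfPlane.denom, Matrix.SpecialLinearGroup.coe_GL_coe_matrix] at this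
  rw [ratio, div_mul_cancel₀]
  simpa using this

lemma log_eq (g : PSLTilde) (z : ℍ) :
    g.log z = g.log UpperHalfPlane.I + Complex.log (ratio (g.mat 1 0) (g.mat 1 1) z) := by
  have key : ∀ z : ℍ, ratio (g.mat 1 0) (g.mat 1 1) z ∈ Complex.slitPlane := fun z =>
    ratio_mem_slitPlane (cd_ne_zero _) z.im_pos
  refine congrFun (eq_of_exp_eq (z₀ := UpperHalfPlane.I) (v := fun z : ℍ =>
    g.log UpperHalfPlane.I + Complex.log (ratio (g.mat 1 0) (g.mat 1 1) z))
    g.continuous_log ?_ ?_ ?_) z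
  · refine continuous_const.add (Continuous.clog ?_ key)
    unfold ratio
    have := UpperHalfPlane.continuous_coe
    fun_prop
  · intro z
    rw [Complex.exp_add, Complex.exp_log (Complex.slitPlane_ne_zero (key z)), g.exp_log,
      g.exp_log, UpperHalfPlane.coe_I, ← ratio_eq g.mat z, mul_comm]
  · have : ratio (g.mat 1 0) (g.mat 1 1) UpperHalfPlane.I = 1 := by
      have := UpperHalfPlane.denom_ne_zero (g.mat : GL (Fin 2) ℝ) UpperHalfPlane.I
      simp only [UpperHalfPlane.denom, Matrix.SpecialLinearGroup.coe_GL_coe_matrix] at this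
      rw [ratio, UpperHalfPlane.coe_I, div_self]
      simpa using this
    rw [this]; simp

/-- The matrix of the element with the given global coordinates. -/
noncomputable def coordInvMat (p : ℝ × ℂ) : SL(2, ℝ) :=
  ⟨!![p.1 * (Complex.exp p.2).im + (Complex.exp p.2).re / Complex.normSq (Complex.exp p.2),
      p.1 * (Complex.exp p.2).re - (Complex.exp p.2).im / Complex.normSq (Complex.exp p.2);
      (Complex.exp p.2).im, (Complex.exp p.2).re], by
    have h : Complex.normSq (Complex.exp p.2) ≠ 0 := by simp [Complex.exp_ne_zero]
    rw [Matrix.det_fin_two_of]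
    field_simp
    rw [Complex.normSq_apply]
    ring⟩

lemma coordInvMat_smul_I (p : ℝ × ℂ) :
    ((coordInvMat p • UpperHalfPlane.I : ℍ) : ℂ) =
      p.1 + (1 / Complex.normSq (Complex.exp p.2) : ℝ) * Complex.I := by
  have h : Complex.normSq (Complex.exp p.2) ≠ 0 := by simp [Complex.exp_ne_zero]
  have h0 : ((Complex.exp p.2).im : ℂ) * Complex.I + (Complex.exp p.2).re ≠ 0 := by
    rw [add_comm, Complex.re_add_im]; exact Complex.exp_ne_zero _
  rw [UpperHalfPlane.coe_specialLinearGroup_apply]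
  simp only [coordInvMat, Matrix.of_apply, Matrix.cons_val', Matrix.cons_val_zero,
    Matrix.cons_val_one, Matrix.cons_val_fin_one, UpperHalfPlane.coe_I,
    Algebra.algebraMap_self, RingHom.id_apply]
  rw [div_eq_iff h0]
  have h' : (Complex.normSq (Complex.exp p.2) : ℂ) ≠ 0 := by exact_mod_cast h
  push_cast
  field_simp
  linear_combination (-((Complex.exp p.2).im : ℂ)) * Complex.I_sq

/-- The element with the given global coordinates. -/
noncomputable def coordInv (p : ℝ × ℂ) : PSLTilde where
  mat := coordInvMat p
  log z := p.2 + Complex.log (ratio (coordInvMat p 1 0) (coordInvMat p 1 1) z)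
  continuous_log := by
    refine continuous_const.add (Continuous.clog ?_ fun z =>
      ratio_mem_slitPlane (cd_ne_zero _) z.im_pos)
    unfold ratio
    have := UpperHalfPlane.continuous_coe
    fun_prop
  exp_log z := by
    rw [Complex.exp_add, Complex.exp_log (Complex.slitPlane_ne_zero
      (ratio_mem_slitPlane (cd_ne_zero _) z.im_pos)), ← ratio_eq, mul_comm]
    congr 1
    simp only [coordInvMat, Matrix.of_apply, Matrix.cons_val', Matrix.cons_val_zero,
      Matrix.cons_val_one, Matrix.cons_val_fin_one]
    rw [add_comm, Complex.re_add_im]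

/-- Global coordinates: the real part of `A i`, and the chosen logarithm of `c i + d`. -/
noncomputable def coord (g : PSLTilde) : ℝ × ℂ :=
  ((g.mat • UpperHalfPlane.I : ℍ).re, g.log UpperHalfPlane.I)

lemma ratio_I (A : SL(2, ℝ)) : ratio (A 1 0) (A 1 1) Complex.I = 1 := by
  have := UpperHalfPlane.denom_ne_zero (A : GL (Fin 2) ℝ) UpperHalfPlane.I
  simp only [UpperHalfPlane.denom, Matrix.SpecialLinearGroup.coe_GL_coe_matrix] at this
  rw [ratio, div_self]
  simpa using this

lemma coord_coordInv (p : ℝ × ℂ) : coord (coordInv p) = p := by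
  refine Prod.ext ?_ ?_
  · change (coordInvMat p • UpperHalfPlane.I : ℍ).re = p.1
    rw [← UpperHalfPlane.coe_re, coordInvMat_smul_I]
    simp
  · change p.2 + Complex.log (ratio (coordInvMat p 1 0) (coordInvMat p 1 1) UpperHalfPlane.I) = p.2
    rw [UpperHalfPlane.coe_I, ratio_I]
    simp

lemma exp_log_I (g : PSLTilde) : (Complex.exp (g.log UpperHalfPlane.I)).re = g.mat 1 1 ∧
    (Complex.exp (g.log UpperHalfPlane.I)).im = g.mat 1 0 := by
  rw [g.exp_log]; simp

lemma re_aux {a b c d : ℝ} (h : c ≠ 0 ∨ d ≠ 0) :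
    (((a : ℂ) * Complex.I + b) / ((c : ℂ) * Complex.I + d)).re * (c ^ 2 + d ^ 2) =
      a * c + b * d := by
  have hn : 0 < c ^ 2 + d ^ 2 := by
    rcases h with h | h <;> positivity
  have hn' : Complex.normSq ((c : ℂ) * Complex.I + d) = c ^ 2 + d ^ 2 := by
    simp [Complex.normSq_apply]; ring
  rw [Complex.div_re, hn']
  simp
  field_simp
  ring

lemma coord_injective : Function.Injective coord := by
  intro g h hgh
  have h1 : (g.mat • UpperHalfPlane.I : ℍ).re = (h.mat • UpperHalfPlane.I : ℍ).re :=
    congrArg Prod.fst hgh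
  have h2 : g.log UpperHalfPlane.I = h.log UpperHalfPlane.I := congrArg Prod.snd hgh
  have h3 : g.mat 1 1 = h.mat 1 1 := by rw [← (exp_log_I g).1, h2, (exp_log_I h).1]
  have h4 : g.mat 1 0 = h.mat 1 0 := by rw [← (exp_log_I g).2, h2, (exp_log_I h).2]
  have re_eq : ∀ g : PSLTilde, (g.mat • UpperHalfPlane.I : ℍ).re * (g.mat 1 0 ^ 2 + g.mat 1 1 ^ 2)
      = g.mat 0 0 * g.mat 1 0 + g.mat 0 1 * g.mat 1 1 := by
    intro g
    rw [← UpperHalfPlane.coe_re, UpperHalfPlane.coe_specialLinearGroup_apply]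
    exact re_aux (cd_ne_zero g.mat)
  have hmat : g.mat = h.mat := by
    have hn : g.mat 1 0 ^ 2 + g.mat 1 1 ^ 2 ≠ 0 := by
      rcases cd_ne_zero g.mat with h | h <;> positivity
    have dg := g.mat.det_coe
    have dh := h.mat.det_coe
    rw [Matrix.det_fin_two] at dg dh
    have rg := re_eq g
    have rh := re_eq h
    rw [h1] at rg
    rw [← h3, ← h4] at rh dh
    have e0 : g.mat 0 0 * g.mat 1 0 + g.mat 0 1 * g.mat 1 1 =
      h.mat 0 0 * g.mat 1 0 + h.mat 0 1 * g.mat 1 1 := by rw [← rg, ← rh]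
    have e1 : g.mat 0 0 = h.mat 0 0 := by
      refine mul_right_cancel₀ hn ?_
      linear_combination g.mat 1 0 * e0 + g.mat 1 1 * (dg - dh)
    have e2 : g.mat 0 1 = h.mat 0 1 := by
      refine mul_right_cancel₀ hn ?_
      linear_combination g.mat 1 1 * e0 - g.mat 1 0 * (dg - dh)
    ext i j
    fin_cases i <;> fin_cases j
    · exact e1
    · exact e2
    · exact h4
    · exact h3
  refine PSLTilde.ext hmat (funext fun z => ?_)
  rw [log_eq g, log_eq h, h2, hmat]

lemma coordInv_coord (g : PSLTilde) : coordInv (coord g) = g :=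
  coord_injective (coord_coordInv _)

/-- The global coordinates identify the group with `ℝ × ℂ`, that is, with `ℝ³`. -/
noncomputable def coordHomeo : PSLTilde ≃ₜ ℝ × ℂ where
  toFun := coord
  invFun := coordInv
  left_inv := coordInv_coord
  right_inv := coord_coordInv
  continuous_toFun := by
    have h : Continuous fun g : PSLTilde => (g.mat, g.log UpperHalfPlane.I) :=
      continuous_induced_dom
    refine Continuous.prodMk ?_ h.snd
    have : Continuous fun A : SL(2, ℝ) => (A • UpperHalfPlane.I : ℍ).re := by
      have e : (fun A : SL(2, ℝ) => (A • UpperHalfPlane.I : ℍ).re) = fun A : SL(2, ℝ) =>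
          (((A 0 0 : ℂ) * Complex.I + A 0 1) / ((A 1 0 : ℂ) * Complex.I + A 1 1)).re := by
        funext A
        rw [← UpperHalfPlane.coe_re, UpperHalfPlane.coe_specialLinearGroup_apply]
        simp
      rw [e]
      have hc : ∀ i j, Continuous fun A : SL(2, ℝ) => ((A i j : ℝ) : ℂ) := fun i j =>
        Complex.continuous_ofReal.comp
          ((continuous_apply_apply i j).comp continuous_subtype_val)
      refine Complex.continuous_re.comp (Continuous.div ?_ ?_ fun A => ?_)
      · exact ((hc 0 0).mul continuous_const).add (hc 0 1)
      · exact ((hc 1 0).mul continuous_const).add (hc 1 1)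
      · have := UpperHalfPlane.denom_ne_zero (A : GL (Fin 2) ℝ) UpperHalfPlane.I
        simpa [UpperHalfPlane.denom] using this
    exact this.comp h.fst
  continuous_invFun := by
    refine continuous_induced_rng.2 (Continuous.prodMk ?_ ?_)
    · refine continuous_induced_rng.2 ?_
      have hn : ∀ p : ℝ × ℂ, Complex.normSq (Complex.exp p.2) ≠ 0 := fun p => by
        simp [Complex.exp_ne_zero]
      have hN : Continuous fun p : ℝ × ℂ => Complex.normSq (Complex.exp p.2) :=
        Complex.continuous_normSq.comp (by fun_prop)
      refine continuous_matrix fun i j => ?_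
      fin_cases i <;> fin_cases j
      · change Continuous fun p : ℝ × ℂ => p.1 * (Complex.exp p.2).im +
          (Complex.exp p.2).re / Complex.normSq (Complex.exp p.2)
        fun_prop (disch := exact hn)
      · change Continuous fun p : ℝ × ℂ => p.1 * (Complex.exp p.2).re -
          (Complex.exp p.2).im / Complex.normSq (Complex.exp p.2)
        fun_prop (disch := exact hn)
      · change Continuous fun p : ℝ × ℂ => (Complex.exp p.2).im
        fun_prop
      · change Continuous fun p : ℝ × ℂ => (Complex.exp p.2).re
        fun_prop
    · have : (fun p => (coordInv p).log UpperHalfPlane.I) = fun p => p.2 :=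
        funext fun p => congrArg Prod.snd (coord_coordInv p)
      change Continuous fun p => (coordInv p).log UpperHalfPlane.I
      rw [this]
      exact continuous_snd

/-- The smooth structure is the one of the global coordinates; it is the Lie group structure. -/
noncomputable instance : ChartedSpace (ℝ × ℂ) PSLTilde :=
  coordHomeo.toOpenPartialHomeomorph.singletonChartedSpace rfl

lemma exp_normSq_ne (w : ℂ) : Complex.normSq (Complex.exp w) ≠ 0 := by
  simp [Complex.exp_ne_zero]

lemma contDiff_coordInvMat (i j : Fin 2) :
    ContDiff ℝ ∞ fun p : ℝ × ℂ => coordInvMat p i j := by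
  have h0 : ContDiff ℝ ∞ fun p : ℝ × ℂ => Complex.exp p.2 := Complex.contDiff_exp.comp contDiff_snd
  have hre : ContDiff ℝ ∞ fun p : ℝ × ℂ => (Complex.exp p.2).re := Complex.reCLM.contDiff.comp h0
  have him : ContDiff ℝ ∞ fun p : ℝ × ℂ => (Complex.exp p.2).im := Complex.imCLM.contDiff.comp h0
  have hN : ContDiff ℝ ∞ fun p : ℝ × ℂ => Complex.normSq (Complex.exp p.2) := by
    simp only [Complex.normSq_apply]; fun_prop
  fin_cases i <;> fin_cases j
  · exact (contDiff_fst.mul him).add (hre.div hN fun p => exp_normSq_ne _)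
  · exact (contDiff_fst.mul hre).sub (him.div hN fun p => exp_normSq_ne _)
  · exact him
  · exact hre

lemma contDiff_coordPoint :
    ContDiff ℝ ∞ fun p : ℝ × ℂ => ((coordInvMat p • UpperHalfPlane.I : ℍ) : ℂ) := by
  have h0 : ContDiff ℝ ∞ fun p : ℝ × ℂ => Complex.exp p.2 := Complex.contDiff_exp.comp contDiff_snd
  have hre : ContDiff ℝ ∞ fun p : ℝ × ℂ => (Complex.exp p.2).re := Complex.reCLM.contDiff.comp h0
  have him : ContDiff ℝ ∞ fun p : ℝ × ℂ => (Complex.exp p.2).im := Complex.imCLM.contDiff.comp h0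
  have hN : ContDiff ℝ ∞ fun p : ℝ × ℂ => Complex.normSq (Complex.exp p.2) := by
    simp only [Complex.normSq_apply]; fun_prop
  have hY : ContDiff ℝ ∞ fun p : ℝ × ℂ => 1 / Complex.normSq (Complex.exp p.2) :=
    contDiff_const.div hN fun p => exp_normSq_ne _
  simp only [coordInvMat_smul_I]
  exact (Complex.ofRealCLM.contDiff.comp contDiff_fst).add
    ((Complex.ofRealCLM.contDiff.comp hY).mul contDiff_const)

section
variable {E : Type*} [NormedAddCommGroup E] [NormedSpace ℝ E]

lemma denom_ne (A : SL(2, ℝ)) (z : ℍ) : (A 1 0 : ℂ) * z + A 1 1 ≠ 0 := by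
  have := UpperHalfPlane.denom_ne_zero (A : GL (Fin 2) ℝ) z
  simpa [UpperHalfPlane.denom] using this

lemma contDiff_smul {A : E → SL(2, ℝ)} {z : E → ℍ} (hA : ∀ i j, ContDiff ℝ ∞ fun x => A x i j)
    (hz : ContDiff ℝ ∞ fun x => (z x : ℂ)) :
    ContDiff ℝ ∞ fun x => ((A x • z x : ℍ) : ℂ) := by
  have hA' : ∀ i j, ContDiff ℝ ∞ fun x => ((A x i j : ℝ) : ℂ) := fun i j =>
    Complex.ofRealCLM.contDiff.comp (hA i j)
  have e : (fun x => ((A x • z x : ℍ) : ℂ)) = fun x =>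
      ((A x 0 0 : ℂ) * z x + A x 0 1) / ((A x 1 0 : ℂ) * z x + A x 1 1) := by
    funext x
    rw [UpperHalfPlane.coe_specialLinearGroup_apply]
    simp
  rw [e]
  simp only [div_eq_mul_inv]
  exact (((hA' 0 0).mul hz).add (hA' 0 1)).mul ((((hA' 1 0).mul hz).add (hA' 1 1)).inv
    fun x => denom_ne _ _)

lemma contDiff_log_ratio {A : E → SL(2, ℝ)} {z : E → ℍ}
    (hA : ∀ i j, ContDiff ℝ ∞ fun x => A x i j) (hz : ContDiff ℝ ∞ fun x => (z x : ℂ)) :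
    ContDiff ℝ ∞ fun x => Complex.log (ratio (A x 1 0) (A x 1 1) (z x)) := by
  have hA' : ∀ i j, ContDiff ℝ ∞ fun x => ((A x i j : ℝ) : ℂ) := fun i j =>
    Complex.ofRealCLM.contDiff.comp (hA i j)
  have hr : ContDiff ℝ ∞ fun x => ratio (A x 1 0) (A x 1 1) (z x) := by
    simp only [ratio, div_eq_mul_inv]
    refine (((hA' 1 0).mul hz).add (hA' 1 1)).mul
      ((((hA' 1 0).mul contDiff_const).add (hA' 1 1)).inv fun x => ?_)
    simpa using denom_ne (A x) UpperHalfPlane.I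
  refine contDiff_iff_contDiffAt.2 fun x => ?_
  exact ((Complex.contDiffAt_log (n := ∞) (ratio_mem_slitPlane (cd_ne_zero (A x))
    (z x).im_pos)).restrict_scalars ℝ).comp x hr.contDiffAt

end

lemma coordInv_mat (p : ℝ × ℂ) : (coordInv p).mat = coordInvMat p := rfl
lemma coordInv_log (p : ℝ × ℂ) (z : ℍ) : (coordInv p).log z =
    p.2 + Complex.log (ratio (coordInvMat p 1 0) (coordInvMat p 1 1) z) := rfl
lemma coordInv_log_I (p : ℝ × ℂ) : (coordInv p).log UpperHalfPlane.I = p.2 :=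
  congrArg Prod.snd (coord_coordInv p)

lemma contDiff_mul : ContDiff ℝ ∞ fun q : (ℝ × ℂ) × (ℝ × ℂ) =>
    coord (coordInv q.1 * coordInv q.2) := by
  have h1 : ContDiff ℝ ∞ fun q : (ℝ × ℂ) × (ℝ × ℂ) =>
      ((coordInvMat q.2 • UpperHalfPlane.I : ℍ) : ℂ) := contDiff_coordPoint.comp contDiff_snd
  have h2 : ∀ i j, ContDiff ℝ ∞ fun q : (ℝ × ℂ) × (ℝ × ℂ) => coordInvMat q.1 i j :=
    fun i j => (contDiff_coordInvMat i j).comp contDiff_fst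
  simp only [coord, mul_mat, mul_log, coordInv_mat, coordInv_log_I, mul_smul,
    ← UpperHalfPlane.coe_re]
  simp only [coordInv_log]
  refine ContDiff.prodMk (Complex.reCLM.contDiff.comp (contDiff_smul h2 h1)) ?_
  exact (contDiff_fst.snd.add (contDiff_log_ratio h2 h1)).add contDiff_snd.snd

lemma contDiff_inv : ContDiff ℝ ∞ fun p : ℝ × ℂ => coord (coordInv p)⁻¹ := by
  have h2 : ∀ i j, ContDiff ℝ ∞ fun p : ℝ × ℂ => (coordInvMat p)⁻¹ i j := by
    intro i j
    simp only [Matrix.SpecialLinearGroup.SL2_inv_expl]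
    fin_cases i <;> fin_cases j
    · exact contDiff_coordInvMat 1 1
    · exact (contDiff_coordInvMat 0 1).neg
    · exact (contDiff_coordInvMat 1 0).neg
    · exact contDiff_coordInvMat 0 0
  have h3 := contDiff_smul h2 (contDiff_const (c := ((UpperHalfPlane.I : ℍ) : ℂ)))
  simp only [coord, inv_mat, inv_log, coordInv_mat, coordInv_log, ← UpperHalfPlane.coe_re]
  exact ContDiff.prodMk (Complex.reCLM.contDiff.comp h3)
    (contDiff_snd.add (contDiff_log_ratio contDiff_coordInvMat h3)).neg

instance : IsManifold 𝓘(ℝ, ℝ × ℂ) ∞ PSLTilde :=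
  coordHomeo.toOpenPartialHomeomorph.isManifold_singleton rfl

lemma contMDiff_coord : ContMDiff 𝓘(ℝ, ℝ × ℂ) 𝓘(ℝ, ℝ × ℂ) ∞ coord := by
  have := contMDiffOn_extChartAt (I := 𝓘(ℝ, ℝ × ℂ)) (n := ∞) (x := (1 : PSLTilde))
  exact contMDiffOn_univ.1 this

lemma contMDiff_coordInv : ContMDiff 𝓘(ℝ, ℝ × ℂ) 𝓘(ℝ, ℝ × ℂ) ∞ coordInv := by
  have := contMDiffOn_extChartAt_symm (I := 𝓘(ℝ, ℝ × ℂ)) (n := ∞) (1 : PSLTilde)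
  refine contMDiffOn_univ.1 (this.mono ?_)
  rw [extChartAt_target]
  exact fun p _ => ⟨Set.mem_univ p, Set.mem_range_self _⟩

instance : LieGroup 𝓘(ℝ, ℝ × ℂ) ∞ PSLTilde where
  contMDiff_mul := by
    have h : (fun p : PSLTilde × PSLTilde => p.1 * p.2) =
        coordInv ∘ (fun q : (ℝ × ℂ) × (ℝ × ℂ) => coord (coordInv q.1 * coordInv q.2)) ∘
          (fun p => (coord p.1, coord p.2)) := by
      funext p; simp [coordInv_coord]
    rw [h]
    refine contMDiff_coordInv.comp (ContMDiff.comp (I' := 𝓘(ℝ, (ℝ × ℂ) × (ℝ × ℂ)))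
      contDiff_mul.contMDiff ?_)
    rw [modelWithCornersSelf_prod, ← chartedSpaceSelf_prod]
    exact (contMDiff_coord.comp contMDiff_fst).prodMk (contMDiff_coord.comp contMDiff_snd)
  contMDiff_inv := by
    have h : (fun p : PSLTilde => p⁻¹) =
        coordInv ∘ (fun q : ℝ × ℂ => coord (coordInv q)⁻¹) ∘ coord := by
      funext p; simp [coordInv_coord]
    rw [h]
    exact contMDiff_coordInv.comp (contDiff_inv.contMDiff.comp contMDiff_coord)

instance : IsTopologicalGroup PSLTilde := topologicalGroup_of_lieGroup 𝓘(ℝ, ℝ × ℂ) ∞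
instance : T2Space PSLTilde := coordHomeo.symm.t2Space
instance : LocallyCompactSpace PSLTilde := coordHomeo.isClosedEmbedding.locallyCompactSpace
instance : SimplyConnectedSpace PSLTilde := by
  have : ContractibleSpace PSLTilde := coordHomeo.contractibleSpace
  infer_instance

/-- The projection onto `SL(2, ℝ)`. -/
noncomputable def matHom : PSLTilde →* SL(2, ℝ) where
  toFun g := g.mat
  map_one' := rfl
  map_mul' _ _ := rfl

lemma continuous_mat : Continuous fun g : PSLTilde => g.mat :=
  (continuous_induced_dom (f := fun g : PSLTilde => (g.mat, g.log UpperHalfPlane.I))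
    (t := instTopologicalSpaceProd)).fst

lemma continuous_log_I : Continuous fun g : PSLTilde => g.log UpperHalfPlane.I :=
  (continuous_induced_dom (f := fun g : PSLTilde => (g.mat, g.log UpperHalfPlane.I))
    (t := instTopologicalSpaceProd)).snd

lemma matHom_surjective : Function.Surjective matHom := by
  intro A
  refine ⟨{ mat := A
            log := fun z => Complex.log ((A 1 0 : ℂ) * Complex.I + A 1 1) +
              Complex.log (ratio (A 1 0) (A 1 1) z)
            continuous_log := ?_
            exp_log := fun z => ?_ }, rfl⟩
  · refine continuous_const.add (Continuous.clog ?_ fun z =>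
      ratio_mem_slitPlane (cd_ne_zero _) z.im_pos)
    unfold ratio
    have := UpperHalfPlane.continuous_coe
    fun_prop
  · have := denom_ne A UpperHalfPlane.I
    rw [UpperHalfPlane.coe_I] at this
    rw [Complex.exp_add, Complex.exp_log this, Complex.exp_log (Complex.slitPlane_ne_zero
      (ratio_mem_slitPlane (cd_ne_zero _) z.im_pos)), ← ratio_eq A z, mul_comm]

/-- The projection `θ` onto `PSL(2, ℝ)`. -/
noncomputable def toPSL : PSLTilde →* PSL(2, ℝ) := (QuotientGroup.mk' _).comp matHom

lemma isQuotientMap_toPSL : IsQuotientMap toPSL := by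
  have : SigmaCompactSpace PSLTilde := coordHomeo.isClosedEmbedding.sigmaCompactSpace
  have : LocallyCompactSpace (Matrix (Fin 2) (Fin 2) ℝ) :=
    inferInstanceAs (LocallyCompactSpace (Fin 2 → Fin 2 → ℝ))
  have : LocallyCompactSpace SL(2, ℝ) :=
    Matrix.SpecialLinearGroup.isClosedEmbedding_val.locallyCompactSpace
  have h1 : IsOpenMap matHom :=
    MonoidHom.isOpenMap_of_sigmaCompact matHom matHom_surjective continuous_mat
  have h2 : IsOpenMap toPSL := QuotientGroup.isOpenMap_coe.comp h1
  exact h2.isQuotientMap (continuous_quot_mk.comp continuous_mat)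
    (Quot.mk_surjective.comp matHom_surjective)

lemma isDiscrete_ker : IsDiscrete (toPSL.ker : Set PSLTilde) := by
  refine ⟨?_⟩
  refine discreteTopology_of_isOpen_singleton_one (G := toPSL.ker) ?_
  have hU : IsOpen {g : toPSL.ker | |((g : PSLTilde).log UpperHalfPlane.I).im| < 1} :=
    isOpen_lt ((continuous_abs.comp Complex.continuous_im).comp
      (continuous_log_I.comp continuous_subtype_val)) continuous_const
  convert! hU
  ext ⟨g, hg⟩
  simp only [Set.mem_singleton_iff, Set.mem_ofPred_eq]
  constructor
  · intro h
    have : g = 1 := congrArg Subtype.val h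
    subst this
    change |((0 : ℂ)).im| < 1
    simp
  · intro h
    have hc : g.mat ∈ Subgroup.center SL(2, ℝ) := (QuotientGroup.eq_one_iff _).1 hg
    obtain ⟨r, hr, hr'⟩ := Matrix.SpecialLinearGroup.mem_center_iff.1 hc
    have h10 : g.mat 1 0 = 0 := by rw [← hr']; simp
    have h11 : g.mat 1 1 = r := by rw [← hr']; simp
    have h00 : g.mat 0 0 = r := by rw [← hr']; simp
    have h01 : g.mat 0 1 = 0 := by rw [← hr']; simp
    have hexp := g.exp_log UpperHalfPlane.I
    rw [h10, h11] at hexp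
    simp at hexp
    have h2 : Complex.exp (2 * g.log UpperHalfPlane.I) = 1 := by
      rw [two_mul, Complex.exp_add, hexp]; rw [← sq]; exact_mod_cast (by simpa using hr : r ^ 2 = 1)
    obtain ⟨n, hn⟩ := Complex.exp_eq_one_iff.1 h2
    have hn' : g.log UpperHalfPlane.I = ((n * Real.pi : ℝ) : ℂ) * Complex.I := by
      push_cast; linear_combination hn / 2
    rw [hn', Complex.im_ofReal_mul, Complex.I_im, mul_one, abs_mul, abs_of_pos Real.pi_pos] at h
    have hn0 : n = 0 := by
      by_contra hne
      have : (1 : ℝ) ≤ |(n : ℝ)| := by exact_mod_cast Int.one_le_abs hne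
      nlinarith [Real.pi_gt_three]
    rw [hn0] at hn'
    simp at hn'
    rw [hn', Complex.exp_zero] at hexp
    have hr1 : r = 1 := by exact_mod_cast hexp.symm
    refine Subtype.ext (coord_injective (Prod.ext ?_ hn'))
    have : g.mat = 1 := by
      ext i j
      fin_cases i <;> fin_cases j <;> simp [h00, h01, h10, h11, hr1]
    simp [coord, this]

theorem isCoveringMap_toPSL : IsCoveringMap toPSL :=
  (isQuotientMap_toPSL.isQuotientCoveringMap_of_isDiscrete_ker_monoidHom
    isDiscrete_ker).isCoveringMap

/-- The quotient `M_Γ = Γ \ G` of the universal covering group `G` by left multiplication by `Γ`.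
If `Γ` is discrete, its smooth structure is the one for which `G → M_Γ` is a local diffeomorphism. -/
abbrev LatticeQuotient (Γ : Subgroup PSLTilde) : Type := MulAction.orbitRel.Quotient Γ PSLTilde

instance (Γ : Subgroup PSLTilde) [h : DiscreteTopology Γ] : ProperlyDiscontinuousSMul Γ PSLTilde := 
  Γ.properlyDiscontinuousSMul_of_tendsto_cofinite
    (Γ.tendsto_coe_cofinite_of_discrete ⟨h⟩)

/-- The projection `G → M_Γ`. -/
noncomputable def proj (Γ : Subgroup PSLTilde) (P : PSLTilde) : LatticeQuotient Γ := Quotient.mk _ P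

lemma proj_eq_proj {Γ : Subgroup PSLTilde} {P Q : PSLTilde} :
    proj Γ P = proj Γ Q ↔ ∃ γ ∈ Γ, γ * Q = P := by
  rw [proj, proj, Quotient.eq, MulAction.orbitRel_apply]
  constructor
  · rintro ⟨γ, h⟩; exact ⟨γ, γ.2, h⟩
  · rintro ⟨γ, hγ, h⟩; exact ⟨⟨γ, hγ⟩, h⟩

section
variable (Γ : Subgroup PSLTilde) [DiscreteTopology Γ]

lemma isCoveringMap_proj : IsCoveringMap (proj Γ) :=
  (isQuotientCoveringMap_quotientMk_of_properlyDiscontinuousSMul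
    (G := Γ) (E := PSLTilde)).isCoveringMap

lemma isLocalHomeomorph_proj : IsLocalHomeomorph (proj Γ) :=
  (isCoveringMap_proj Γ).isLocalHomeomorph

lemma exists_of_mem_atlas {e : OpenPartialHomeomorph (LatticeQuotient Γ) (ℝ × ℂ)}
    (he : e ∈ atlas (ℝ × ℂ) (LatticeQuotient Γ)) : ∃ P : PSLTilde,
      e = ((isLocalHomeomorph_proj Γ).localInverseAt P).trans (chartAt (ℝ × ℂ) P) := by
  obtain ⟨q, hq⟩ := he
  exact ⟨_, hq.symm⟩

lemma chartAt_eq (P : PSLTilde) :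
    chartAt (ℝ × ℂ) P = coordHomeo.toOpenPartialHomeomorph := by
  rfl

lemma contDiff_left_mul (γ : PSLTilde) : ContDiff ℝ ∞ fun y => coord (γ * coordInv y) :=
  (contMDiff_coord.comp ((contMDiff_mul_left (I := 𝓘(ℝ, ℝ × ℂ)) (a := γ)).comp
    contMDiff_coordInv)).contDiff

lemma localInverseAt_proj_eventuallyEq (P' : PSLTilde) {y : ℝ × ℂ}
    (hs : proj Γ (coordInv y) ∈ ((isLocalHomeomorph_proj Γ).localInverseAt P').source) :
    ∃ γ ∈ Γ, (fun z => coord ((isLocalHomeomorph_proj Γ).localInverseAt P' (proj Γ (coordInv z))))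
      =ᶠ[𝓝 y] fun z => coord (γ * coordInv z) := by
  set hπ := isLocalHomeomorph_proj Γ
  obtain ⟨γ, hγ, hγy⟩ := proj_eq_proj.1 (hπ.apply_localInverseAt_of_mem hs)
  refine ⟨γ, hγ, ?_⟩
  have hc : Continuous fun y => γ * coordInv y :=
    continuous_const.mul coordHomeo.symm.continuous
  have hp : Continuous fun y => proj Γ (coordInv y) :=
    (isCoveringMap_proj Γ).continuous.comp coordHomeo.symm.continuous
  have h1 : ∀ᶠ z in 𝓝 y, γ * coordInv z ∈ (hπ.localInverseAt P').target := by
    refine hc.continuousAt.eventually_mem ((hπ.localInverseAt P').open_target.mem_nhds ?_)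
    rw [hγy]
    exact (hπ.localInverseAt P').map_source hs
  have h2 : ∀ᶠ z in 𝓝 y, proj Γ (coordInv z) ∈ (hπ.localInverseAt P').source :=
    hp.continuousAt.eventually_mem ((hπ.localInverseAt P').open_source.mem_nhds hs)
  filter_upwards [h1, h2] with z hz1 hz2
  congr 1
  refine hπ.injOn_localInverseAt_target ((hπ.localInverseAt P').map_source hz2) hz1 ?_
  rw [hπ.apply_localInverseAt_of_mem hz2]
  exact proj_eq_proj.2 ⟨γ⁻¹, Γ.inv_mem hγ, by simp⟩

instance : IsManifold 𝓘(ℝ, ℝ × ℂ) ∞ (LatticeQuotient Γ) := by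
  refine isManifold_of_contDiffOn _ _ _ fun e e' he he' => ?_
  obtain ⟨P, rfl⟩ := exists_of_mem_atlas Γ he
  obtain ⟨P', rfl⟩ := exists_of_mem_atlas Γ he'
  rintro y ⟨hy, -⟩
  refine ContDiffAt.contDiffWithinAt ?_
  simp only [chartAt_eq, modelWithCornersSelf_coe_symm, Set.preimage_id, modelWithCornersSelf_coe,
    Function.id_comp, Function.comp_id, OpenPartialHomeomorph.trans_source,
    OpenPartialHomeomorph.symm_source, Set.mem_inter_iff, Set.mem_preimage,
    OpenPartialHomeomorph.trans_symm_eq_symm_trans_symm, OpenPartialHomeomorph.coe_trans,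
    IsLocalHomeomorph.localInverseAt_symm] at hy ⊢
  obtain ⟨γ, -, h⟩ := localInverseAt_proj_eventuallyEq Γ P' hy.2.1
  exact (contDiff_left_mul γ).contDiffAt.congr_of_eventuallyEq h

lemma contMDiff_proj : ContMDiff 𝓘(ℝ, ℝ × ℂ) 𝓘(ℝ, ℝ × ℂ) ∞ (proj Γ) := by
  have key : ContMDiff 𝓘(ℝ, ℝ × ℂ) 𝓘(ℝ, ℝ × ℂ) ∞ fun y => proj Γ (coordInv y) := by
    intro y
    refine contMDiffAt_iff_target.2 ⟨((isCoveringMap_proj Γ).continuous.comp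
      coordHomeo.symm.continuous).continuousAt, ?_⟩
    obtain ⟨P', h⟩ := exists_of_mem_atlas Γ (chart_mem_atlas (ℝ × ℂ) (proj Γ (coordInv y)))
    have hs := mem_chart_source (ℝ × ℂ) (proj Γ (coordInv y))
    rw [extChartAt, h]
    rw [h] at hs
    obtain ⟨γ, -, h⟩ := localInverseAt_proj_eventuallyEq Γ P' hs.1
    exact ((contDiff_left_mul γ).contDiffAt.congr_of_eventuallyEq h).contMDiffAt
  have e : proj Γ = (fun y => proj Γ (coordInv y)) ∘ coord := by
    funext P; simp [coordInv_coord]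
  rw [e]
  exact key.comp contMDiff_coord
end

end PSLTilde

section DeRham
variable (E : Type*) [NormedAddCommGroup E] [NormedSpace ℝ E]
  (M : Type*) [TopologicalSpace M] [ChartedSpace E M] [IsManifold 𝓘(ℝ, E) ∞ M]

/-- Smooth one-forms on `M`: smooth sections of the cotangent bundle. -/
abbrev SmoothOneForm : Type _ :=
  ContMDiffSection 𝓘(ℝ, E) (E →L[ℝ] ℝ) ∞
    (fun x : M => TangentSpace 𝓘(ℝ, E) x →L[ℝ] Bundle.Trivial M ℝ x)

variable {E M}
namespace SmoothOneForm

/-- The expression of a one-form in the preferred chart at `x₀`, that is, its pull-back by the inverse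
of the chart. Only its values on the target of the chart matter. -/
noncomputable def inChart (α : SmoothOneForm E M) (x₀ : M) (y : E) : E →L[ℝ] ℝ :=
  (α ((chartAt E x₀).symm y)).comp (mfderiv 𝓘(ℝ, E) 𝓘(ℝ, E) (chartAt E x₀).symm y)

lemma contDiffOn_inChart (α : SmoothOneForm E M) (x₀ : M) :
    ContDiffOn ℝ ∞ (α.inChart x₀) (chartAt E x₀).target := by
  have h1 := ((trivializationAt (E →L[ℝ] ℝ)
    (fun x : M => TangentSpace 𝓘(ℝ, E) x →L[ℝ] Bundle.Trivial M ℝ x) x₀).contMDiffOn_section_iff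
    (IB := 𝓘(ℝ, E)) (n := ∞) (s := α) (a := (chartAt E x₀).source)
      (chartAt E x₀).open_source (fun x hx => ⟨hx, Set.mem_univ _⟩)).1 α.contMDiff.contMDiffOn
  have h2 : ContMDiffOn 𝓘(ℝ, E) 𝓘(ℝ, E) ∞ (chartAt E x₀).symm (chartAt E x₀).target :=
    contMDiffOn_chart_symm
  refine contMDiffOn_iff_contDiffOn.1 ((h1.comp h2 (chartAt E x₀).mapsTo_symm).congr fun y hy => ?_)
  have hs : (chartAt E x₀).symm y ∈ (chartAt E x₀).source := (chartAt E x₀).map_target hy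
  simp only [Function.comp]
  rw [hom_trivializationAt_apply]
  simp only [ContinuousLinearMap.inCoordinates]
  rw [TangentBundle.symmL_trivializationAt hs]
  simp only [inChart, mfld_simps, Set.range_id, mfderivWithin_univ, Function.id_comp,
    Function.comp_id]
  rw [(chartAt E x₀).right_inv hy]
  exact ContinuousLinearMap.ext fun v => (DFunLike.congr_fun
    (Bundle.Trivial.continuousLinearMapAt_trivialization (𝕜 := ℝ) M ℝ
      ((chartAt E x₀).symm y)) _).symm

lemma differentiableAt_inChart (α : SmoothOneForm E M) (x₀ : M) {y : E}
    (hy : y ∈ (chartAt E x₀).target) : DifferentiableAt ℝ (α.inChart x₀) y :=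
  ((α.contDiffOn_inChart x₀).differentiableOn (by simp)).differentiableAt
    ((chartAt E x₀).open_target.mem_nhds hy)

end SmoothOneForm

variable (E M)

/-- Closed one-forms: in each preferred chart the exterior derivative
`dα (v, w) = D_v α (w) - D_w α (v)` vanishes. -/
noncomputable def closedOneForms : Submodule ℝ (SmoothOneForm E M) where
  carrier := {α | ∀ x₀ : M, ∀ y ∈ (chartAt E x₀).target, ∀ v w : E,
    fderiv ℝ (α.inChart x₀) y v w = fderiv ℝ (α.inChart x₀) y w v}
  zero_mem' x₀ y hy v w := by
    have : (0 : SmoothOneForm E M).inChart x₀ = fun _ => 0 :=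
      funext fun y => ContinuousLinearMap.zero_comp _
    simp [this]
  add_mem' {α η} hα hη x₀ y hy v w := by
    have : (α + η).inChart x₀ = α.inChart x₀ + η.inChart x₀ :=
      funext fun y => ContinuousLinearMap.add_comp _ _ _
    rw [this, fderiv_add (α.differentiableAt_inChart x₀ hy) (η.differentiableAt_inChart x₀ hy)]
    simp [hα x₀ y hy v w, hη x₀ y hy v w]
  smul_mem' c α hα x₀ y hy v w := by
    have : (c • α).inChart x₀ = c • α.inChart x₀ :=
      funext fun y => ContinuousLinearMap.smul_comp _ _ _
    rw [this, fderiv_const_smul (α.differentiableAt_inChart x₀ hy)]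
    simp [hα x₀ y hy v w]

/-- Exact one-forms: differentials of smooth functions. -/
noncomputable def exactOneForms : Submodule ℝ (SmoothOneForm E M) where
  carrier := {α | ∃ f : M → ℝ, ContMDiff 𝓘(ℝ, E) 𝓘(ℝ, ℝ) ∞ f ∧
    ∀ (x : M) (v : TangentSpace 𝓘(ℝ, E) x), α x v = mfderiv 𝓘(ℝ, E) 𝓘(ℝ, ℝ) f x v}
  zero_mem' := ⟨fun _ => 0, contMDiff_const, fun x v => by rw [mfderiv_const]; rfl⟩
  add_mem' := by
    rintro α η ⟨f, hf, hα⟩ ⟨g, hg, hη⟩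
    refine ⟨f + g, hf.add hg, fun x v => ?_⟩
    rw [mfderiv_add (hf.mdifferentiable (by simp) x) (hg.mdifferentiable (by simp) x)]
    exact congrArg₂ (· + ·) (hα x v) (hη x v)
  smul_mem' := by
    rintro c α ⟨f, hf, hα⟩
    refine ⟨c • f, contMDiff_const.mul hf, fun x v => ?_⟩
    rw [const_smul_mfderiv (hf.mdifferentiable (by simp) x)]
    exact congrArg (c • ·) (hα x v)

/-- The first de Rham cohomology group. -/
def DeRhamH1 : Type _ :=
  closedOneForms E M ⧸ (exactOneForms E M).submoduleOf (closedOneForms E M)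

noncomputable instance : AddCommGroup (DeRhamH1 E M) :=
  inferInstanceAs (AddCommGroup (_ ⧸ (exactOneForms E M).submoduleOf (closedOneForms E M)))
noncomputable instance : Module ℝ (DeRhamH1 E M) :=
  inferInstanceAs (Module ℝ (_ ⧸ (exactOneForms E M).submoduleOf (closedOneForms E M)))

/-- The module topology. If the cohomology group is finite-dimensional, as it is for a compact
manifold, this is the usual topology of a finite-dimensional real vector space. -/
noncomputable instance : TopologicalSpace (DeRhamH1 E M) := moduleTopology ℝ (DeRhamH1 E M)

/-- The cohomology class of a closed one-form. -/
noncomputable def DeRhamH1.mk : closedOneForms E M →ₗ[ℝ] DeRhamH1 E M :=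
  Submodule.mkQ _

variable {E M}

namespace SmoothOneForm

/-- The integral of a one-form along a smooth curve `c : [0, 1] → M`. -/
noncomputable def lineIntegral (α : SmoothOneForm E M) (c : ℝ → M) : ℝ :=
  ∫ t in (0 : ℝ)..1, α (c t) (mfderiv 𝓘(ℝ, ℝ) 𝓘(ℝ, E) c t (1 : ℝ))

lemma continuous_lineIntegrand (α : SmoothOneForm E M) {c : ℝ → M}
    (hc : ContMDiff 𝓘(ℝ, ℝ) 𝓘(ℝ, E) ∞ c) :
    Continuous fun t : ℝ => α (c t) (mfderiv 𝓘(ℝ, ℝ) 𝓘(ℝ, E) c t (1 : ℝ)) := by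
  have h1 : ContMDiff 𝓘(ℝ, ℝ) (𝓘(ℝ, E).prod 𝓘(ℝ, E →L[ℝ] ℝ)) ∞
      fun t => Bundle.TotalSpace.mk' (E →L[ℝ] ℝ)
        (E := fun x : M => TangentSpace 𝓘(ℝ, E) x →L[ℝ] Bundle.Trivial M ℝ x) (c t) (α (c t)) :=
    α.contMDiff.comp hc
  have h0 : ContMDiff 𝓘(ℝ, ℝ) 𝓘(ℝ, ℝ).tangent ∞
      fun t : ℝ => (⟨t, (1 : ℝ)⟩ : TangentBundle 𝓘(ℝ, ℝ) ℝ) := by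
    intro t
    rw [Bundle.contMDiffAt_totalSpace]
    refine ⟨contMDiffAt_id, ?_⟩
    simp
    exact contMDiffAt_const
  have h2 : ContMDiff 𝓘(ℝ, ℝ) (𝓘(ℝ, E).prod 𝓘(ℝ, E)) ∞
      fun t => Bundle.TotalSpace.mk' E (E := fun x : M => TangentSpace 𝓘(ℝ, E) x) (c t)
        (mfderiv 𝓘(ℝ, ℝ) 𝓘(ℝ, E) c t (1 : ℝ)) :=
    (hc.contMDiff_tangentMap (by simp)).comp h0
  have h3 := ContMDiff.clm_bundle_apply h1 h2
  have h4 : ContMDiff 𝓘(ℝ, ℝ) 𝓘(ℝ, ℝ) ∞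
      fun t : ℝ => α (c t) (mfderiv 𝓘(ℝ, ℝ) 𝓘(ℝ, E) c t (1 : ℝ)) := by
    intro t
    have := (Bundle.contMDiffAt_totalSpace.1 (h3 t)).2
    simpa using this
  exact h4.continuous

/-- The integral along a smooth curve as a linear functional on one-forms. -/
noncomputable def lineIntegralₗ (c : ℝ → M) (hc : ContMDiff 𝓘(ℝ, ℝ) 𝓘(ℝ, E) ∞ c) :
    SmoothOneForm E M →ₗ[ℝ] ℝ where
  toFun α := α.lineIntegral c
  map_add' α η := by
    simp only [lineIntegral]
    rw [← intervalIntegral.integral_add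
      ((α.continuous_lineIntegrand hc).intervalIntegrable _ _)
      ((η.continuous_lineIntegrand hc).intervalIntegrable _ _)]
    rfl
  map_smul' a α := by
    simp only [lineIntegral]
    rw [RingHom.id_apply, smul_eq_mul, ← intervalIntegral.integral_const_mul]
    rfl

lemma lineIntegral_of_exact {α : SmoothOneForm E M} (hα : α ∈ exactOneForms E M) {c : ℝ → M}
    (hc : ContMDiff 𝓘(ℝ, ℝ) 𝓘(ℝ, E) ∞ c) (hloop : c 0 = c 1) : α.lineIntegral c = 0 := by
  obtain ⟨f, hf, h⟩ := hα
  have hd : ∀ t : ℝ, HasDerivAt (f ∘ c)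
      (α (c t) (mfderiv 𝓘(ℝ, ℝ) 𝓘(ℝ, E) c t (1 : ℝ))) t := by
    intro t
    rw [h]
    have h1 : HasMFDerivAt 𝓘(ℝ, ℝ) 𝓘(ℝ, ℝ) (f ∘ c) t _ :=
      (hf.mdifferentiable (by simp) (c t)).hasMFDerivAt.comp t
        (hc.mdifferentiable (by simp) t).hasMFDerivAt
    have h2 := (hasMFDerivAt_iff_hasFDerivAt (E := ℝ) (E' := ℝ)).1 h1
    exact HasFDerivAt.hasDerivAt (𝕜 := ℝ) (F := ℝ) h2
  rw [lineIntegral, intervalIntegral.integral_eq_sub_of_hasDerivAt (fun t _ => hd t)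
    ((α.continuous_lineIntegrand hc).intervalIntegrable _ _)]
  simp [hloop]

end SmoothOneForm
end DeRham

section
variable {E : Type*} [NormedAddCommGroup E] [NormedSpace ℝ E]
  {M : Type*} [TopologicalSpace M] [ChartedSpace E M] [IsManifold 𝓘(ℝ, E) ∞ M]

lemma exactOneForms_le_closedOneForms : exactOneForms E M ≤ closedOneForms E M := by
  rintro α ⟨f, hf, h⟩ x₀ y hy v w
  have ho := (chartAt E x₀).open_target
  have hφ : ContMDiffOn 𝓘(ℝ, E) 𝓘(ℝ, E) ∞ (chartAt E x₀).symm (chartAt E x₀).target :=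
    contMDiffOn_chart_symm
  have hg : ContMDiffOn 𝓘(ℝ, E) 𝓘(ℝ, ℝ) ∞ (f ∘ (chartAt E x₀).symm) (chartAt E x₀).target :=
    hf.comp_contMDiffOn hφ
  have hg2 : ContDiffAt ℝ ∞ (f ∘ (chartAt E x₀).symm) y :=
    (contMDiffOn_iff_contDiffOn.1 hg).contDiffAt (ho.mem_nhds hy)
  have heq : α.inChart x₀ =ᶠ[𝓝 y] fderiv ℝ (f ∘ (chartAt E x₀).symm) := by
    filter_upwards [ho.mem_nhds hy] with z hz
    have h1 := (hf.mdifferentiable (by simp) ((chartAt E x₀).symm z)).hasMFDerivAt.comp z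
      ((hφ.contMDiffAt (ho.mem_nhds hz)).mdifferentiableAt (by simp)).hasMFDerivAt
    rw [← mfderiv_eq_fderiv, h1.mfderiv]
    exact ContinuousLinearMap.ext fun v => h _ _
  rw [heq.fderiv_eq]
  exact hg2.isSymmSndFDerivAt (by simpa using ENat.LEInfty.out) v w
end

namespace PSLTilde

section
/-- The translation length `inf_z d(z, P z)` on the hyperbolic plane. -/
noncomputable def translationLength (P : PSLTilde) : ℝ := ⨅ z : ℍ, dist z (P.mat • z)

/-- The one-parameter subgroup `X^t` over the diagonal matrices `diag (e^(t/2), e^(-t/2))`. -/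
noncomputable def diagX (t : ℝ) : PSLTilde where
  mat := ⟨!![Real.exp (t / 2), 0; 0, Real.exp (-(t / 2))], by
    rw [Matrix.det_fin_two_of, ← Real.exp_add]; simp⟩
  log _ := -((t / 2 : ℝ) : ℂ)
  continuous_log := continuous_const
  exp_log z := by simp [Complex.ofReal_exp]

lemma coord_diagX (t : ℝ) : coord (diagX t) = (0, -((t / 2 : ℝ) : ℂ)) := by
  refine Prod.ext ?_ rfl
  change (((diagX t).mat • UpperHalfPlane.I : ℍ)).re = 0
  rw [← UpperHalfPlane.coe_re, UpperHalfPlane.coe_specialLinearGroup_apply]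
  simp [diagX, Complex.div_re, -Complex.ofReal_exp]

lemma diagX_add (s t : ℝ) : diagX (s + t) = diagX s * diagX t := by
  refine PSLTilde.ext ?_ (funext fun z => ?_)
  · refine Subtype.ext ?_
    change !![Real.exp ((s + t) / 2), 0; 0, Real.exp (-((s + t) / 2))] =
      !![Real.exp (s / 2), 0; 0, Real.exp (-(s / 2))] *
        !![Real.exp (t / 2), 0; 0, Real.exp (-(t / 2))]
    rw [Matrix.mul_fin_two, add_div, neg_add, Real.exp_add, Real.exp_add]
    simp
  · change -(((s + t) / 2 : ℝ) : ℂ) = -((s / 2 : ℝ) : ℂ) + -((t / 2 : ℝ) : ℂ)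
    push_cast; ring

variable (Γ : Subgroup PSLTilde)

/-- The flow `Γ P ↦ Γ P X^t` on `M_Γ`. -/
noncomputable def flow (t : ℝ) : LatticeQuotient Γ → LatticeQuotient Γ :=
  Quotient.map' (fun P => P * diagX t) (by
    rintro P Q ⟨γ, h⟩
    exact ⟨γ, by rw [← h]; exact (mul_assoc _ _ _).symm⟩)

lemma flow_proj (t : ℝ) (P : PSLTilde) : flow Γ t (proj Γ P) = proj Γ (P * diagX t) := rfl

/-- The loop in `M_Γ` representing `γ ∈ Γ` under the identification of `Γ` with the fundamental group
of `M_Γ` based at `Γ 1`: the projection of a path in `G` from `1` to `γ`. Since `G` is simply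
connected the choice of the path does not matter up to homotopy; the path chosen here is the
straight segment in the global coordinates. -/
noncomputable def loop (γ : PSLTilde) (t : ℝ) : LatticeQuotient Γ :=
  proj Γ (coordInv (AffineMap.lineMap (coord 1) (coord γ) t))

lemma loop_zero_eq_one {γ : PSLTilde} (hγ : γ ∈ Γ) : loop Γ γ 0 = loop Γ γ 1 := by
  simp only [loop, AffineMap.lineMap_apply_zero, AffineMap.lineMap_apply_one, coordInv_coord]
  exact proj_eq_proj.2 ⟨γ⁻¹, Γ.inv_mem hγ, by simp⟩

variable [DiscreteTopology Γ]

/-- The vector field `X_Γ` on `M_Γ` generating the flow `Γ P ↦ Γ P X^t`. -/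
noncomputable def generatorX (p : LatticeQuotient Γ) : TangentSpace 𝓘(ℝ, ℝ × ℂ) p :=
  mfderiv 𝓘(ℝ, ℝ) 𝓘(ℝ, ℝ × ℂ) (fun t : ℝ => flow Γ t p) 0 (1 : ℝ)

lemma contMDiff_flow_line (p : LatticeQuotient Γ) :
    ContMDiff 𝓘(ℝ, ℝ) 𝓘(ℝ, ℝ × ℂ) ∞ fun t : ℝ => flow Γ t p := by
  obtain ⟨P, rfl⟩ := Quotient.mk_surjective p
  change ContMDiff 𝓘(ℝ, ℝ) 𝓘(ℝ, ℝ × ℂ) ∞ fun t : ℝ => proj Γ (P * diagX t)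
  have h : (fun t => diagX t) = fun t => coordInv (0, -((t / 2 : ℝ) : ℂ)) := by
    funext t; rw [← coord_diagX, coordInv_coord]
  have h1 : ContMDiff 𝓘(ℝ, ℝ) 𝓘(ℝ, ℝ × ℂ) ∞ fun t : ℝ => diagX t := by
    rw [h]
    refine contMDiff_coordInv.comp (ContDiff.contMDiff ?_)
    exact contDiff_const.prodMk (Complex.ofRealCLM.contDiff.comp (contDiff_id.div_const 2)).neg
  exact (contMDiff_proj Γ).comp (contMDiff_const.mul h1)

lemma contMDiff_loop (γ : PSLTilde) : ContMDiff 𝓘(ℝ, ℝ) 𝓘(ℝ, ℝ × ℂ) ∞ (loop Γ γ) :=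
  (contMDiff_proj Γ).comp (contMDiff_coordInv.comp
    (ContDiff.contMDiff (f := fun t : ℝ => AffineMap.lineMap (coord 1) (coord γ) t)
      (by simp only [AffineMap.lineMap_apply_module]; fun_prop)))

/-- The evaluation `a ↦ a(γ)` of cohomology classes on `γ ∈ Γ`: the integral of a representing closed
one-form along a loop representing `γ`. -/
noncomputable def eval (γ : Γ) : DeRhamH1 (ℝ × ℂ) (LatticeQuotient Γ) →ₗ[ℝ] ℝ :=
  Submodule.liftQ _
    ((SmoothOneForm.lineIntegralₗ (loop Γ γ) (contMDiff_loop Γ γ)).comp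
      (closedOneForms (ℝ × ℂ) (LatticeQuotient Γ)).subtype)
    fun α hα => SmoothOneForm.lineIntegral_of_exact (Submodule.mem_comap.1 hα)
      (contMDiff_loop Γ γ) (loop_zero_eq_one Γ γ.2)

lemma eval_mk (γ : Γ)
    (α : closedOneForms (ℝ × ℂ) (LatticeQuotient Γ)) :
    eval Γ γ (DeRhamH1.mk _ _ α) = (α : SmoothOneForm (ℝ × ℂ) (LatticeQuotient Γ)).lineIntegral (loop Γ γ) :=
  rfl

/-- The set `Δ_Γ` of the classes `a` with `sup {|a(γ)| / L(γ) | γ ∈ Γ, L(γ) ≠ 0} < 1`, where the supremum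
is taken in the extended reals. -/
def Delta : Set (DeRhamH1 (ℝ × ℂ) (LatticeQuotient Γ)) :=
  {a | ⨆ γ : {γ : Γ // translationLength γ ≠ 0},
    ((|eval Γ γ a| / translationLength (γ : Γ) : ℝ) : EReal) < 1}

end

end PSLTilde

/-!
A closed one-form on `M_Γ` has a primitive `F` on the universal covering `G`, and
`F (γ P) = F P + a(γ)` for `γ ∈ Γ`, where `a` is the class of the form (`exists_primitive`). Both
parts of the theorem compare the periods `a(γ)` with the increments of `F` along the flow lines
`t ↦ P X^t`.

*From increments to periods* (`abs_period_le`). By the Cartan decomposition `g = k X^t k'`, where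
`t = d(i, g i)` and `k`, `k'` lie in the universal covering `K` of the rotation group, a lower
bound `F (P X^t) - F P ≥ -k t - B` gives `F (P g) - F P ≥ -k d(i, g i) - B'`, provided that `F`
varies boundedly along the cosets of the non-compact group `K`. For the compact part of `K` this is
compactness of `M_Γ`; for the central part it is `exists_increment_bound_central`: the function
`P ↦ F (P c) - F P` on `M_Γ` has oscillation bounded independently of the central element `c`, and
its mean for the invariant measure is a homomorphism from the perfect group `G` to `ℝ` as a function
of `c ∈ G`, hence vanishes (`exists_increment_mean_eq_zero`). Applying the bound to powers of `γ`
removes the constant and gives `|a(γ)| ≤ k L(γ)`, for all `γ` at once, without any distinction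
between hyperbolic, elliptic and parabolic elements. As some such bound holds for every class,
the normalised periods `a(γ) / L(γ)` form a linear map from `H¹` to bounded functions. It is
continuous for the module topology, and `Δ_Γ` is the preimage of the open unit ball.

*From periods to increments* (`exists_flow_increment_ge`). By compactness of `M_Γ` the end of a flow
line from `P` of length `T` is `γ P q` with `γ ∈ Γ` and `q` in a fixed compact set, so that
`L(γ) ≤ T + O(1)` and `F (P X^T) - F P = a(γ) + O(1) ≥ -k T - O(1)`. Averaging a representative of
`a` along the flow during the time `T` gives a cohomologous form whose value on the generator is
`(F (P X^T) - F P) / T` (`exists_cohomologous`), and this exceeds `-1` uniformly if `k < 1` and `T`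
is large.
-/

/-! ### Primitives of closed one-forms on the universal covering -/

section Velocity
variable {E M : Type*} [NormedAddCommGroup E] [NormedSpace ℝ E] [TopologicalSpace M]
  [ChartedSpace E M]

/-- The velocity of a curve, as a vector of the model space. Tangent spaces at points of a curve
are thereby compared without comparing the points. -/
noncomputable def velocity (c : ℝ → M) (t : ℝ) : E := mfderiv 𝓘(ℝ, ℝ) 𝓘(ℝ, E) c t (1 : ℝ)

lemma velocity_comp_sub_const {c : ℝ → M} (hc : MDifferentiableAt 𝓘(ℝ, ℝ) 𝓘(ℝ, E) c 0) (t : ℝ) :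
    (velocity (fun s => c (s - t)) t : E) = velocity c 0 := by
  have h0 : HasMFDerivAt 𝓘(ℝ, ℝ) 𝓘(ℝ, ℝ) (fun s : ℝ => s - t) t (ContinuousLinearMap.id ℝ ℝ) :=
    ((hasFDerivAt_id t).sub_const t).hasMFDerivAt
  have h1 : HasMFDerivAt 𝓘(ℝ, ℝ) 𝓘(ℝ, E) c (t - t) (mfderiv 𝓘(ℝ, ℝ) 𝓘(ℝ, E) c 0) := by
    rw [sub_self]
    exact hc.hasMFDerivAt
  have h2 := (HasMFDerivAt.comp (f := fun s : ℝ => s - t) t h1 h0).mfderiv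
  exact congrArg (fun L : ℝ →L[ℝ] E => L 1) h2

/-- The pull-back of a one-form under a map `π` that is invariant under `τ` is invariant under `τ`. -/
lemma comp_mfderiv_of_comp_eq {π : E → M} {τ : E → E} {y : E} (hπτ : π ∘ τ = π)
    (hπ : MDifferentiableAt 𝓘(ℝ, E) 𝓘(ℝ, E) π (τ y)) (hτ : DifferentiableAt ℝ τ y)
    (A : ∀ x : M, TangentSpace 𝓘(ℝ, E) x →L[ℝ] ℝ) :
    ((A (π y)).comp (mfderiv 𝓘(ℝ, E) 𝓘(ℝ, E) π y) : E →L[ℝ] ℝ) =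
      ContinuousLinearMap.comp ((A (π (τ y))).comp (mfderiv 𝓘(ℝ, E) 𝓘(ℝ, E) π (τ y)) : E →L[ℝ] ℝ)
        (fderiv ℝ τ y) := by
  have hc := hπ.hasMFDerivAt.comp y hτ.hasFDerivAt.hasMFDerivAt
  rw [hπτ] at hc
  have hp : π (τ y) = π y := congrFun hπτ y
  rw [hc.mfderiv, hp]
  rfl

end Velocity

namespace PSLTilde

lemma proj_mul_left {Γ : Subgroup PSLTilde} {γ : PSLTilde} (hγ : γ ∈ Γ) (P : PSLTilde) :
    proj Γ (γ * P) = proj Γ P :=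
  proj_eq_proj.2 ⟨γ, hγ, rfl⟩

section Primitive
variable (Γ : Subgroup PSLTilde) [DiscreteTopology Γ]

lemma chartAt_symm_eq (x₀ : LatticeQuotient Γ) :
    ((chartAt (ℝ × ℂ) x₀).symm : ℝ × ℂ → LatticeQuotient Γ) = fun y => proj Γ (coordInv y) := by
  obtain ⟨P, hP⟩ := exists_of_mem_atlas Γ (chart_mem_atlas (ℝ × ℂ) x₀)
  rw [hP, OpenPartialHomeomorph.trans_symm_eq_symm_trans_symm, OpenPartialHomeomorph.coe_trans,
    IsLocalHomeomorph.localInverseAt_symm, chartAt_eq]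
  rfl

lemma contMDiff_proj_coordInv :
    ContMDiff 𝓘(ℝ, ℝ × ℂ) 𝓘(ℝ, ℝ × ℂ) ∞ fun y => proj Γ (coordInv y) :=
  (contMDiff_proj Γ).comp contMDiff_coordInv

variable {Γ}

/-- The pull-back of a one-form on `M_Γ` to the global coordinates of the universal covering. -/
noncomputable def pullCoord (α : SmoothOneForm (ℝ × ℂ) (LatticeQuotient Γ)) (y : ℝ × ℂ) :
    ℝ × ℂ →L[ℝ] ℝ :=
  (α (proj Γ (coordInv y))).comp
    (mfderiv 𝓘(ℝ, ℝ × ℂ) 𝓘(ℝ, ℝ × ℂ) (fun y => proj Γ (coordInv y)) y)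

lemma inChart_eq_pullCoord (α : SmoothOneForm (ℝ × ℂ) (LatticeQuotient Γ))
    (x₀ : LatticeQuotient Γ) : α.inChart x₀ = pullCoord α := by
  have aux : ∀ g h : ℝ × ℂ → LatticeQuotient Γ, g = h → (fun y => (α (g y)).comp
      (mfderiv 𝓘(ℝ, ℝ × ℂ) 𝓘(ℝ, ℝ × ℂ) g y)) = fun y => (α (h y)).comp
      (mfderiv 𝓘(ℝ, ℝ × ℂ) 𝓘(ℝ, ℝ × ℂ) h y) := by
    rintro g _ rfl
    rfl
  exact aux _ _ (chartAt_symm_eq Γ x₀)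

lemma pullCoord_left_mul (α : SmoothOneForm (ℝ × ℂ) (LatticeQuotient Γ)) {γ : PSLTilde}
    (hγ : γ ∈ Γ) (y : ℝ × ℂ) : pullCoord α y =
      (pullCoord α (coord (γ * coordInv y))).comp
        (fderiv ℝ (fun y => coord (γ * coordInv y)) y) := by
  refine comp_mfderiv_of_comp_eq (π := fun y => proj Γ (coordInv y)) (funext fun z => ?_)
    ((contMDiff_proj_coordInv Γ).mdifferentiable (by simp) _)
    ((contDiff_left_mul γ).differentiable (by simp) y) (fun x => α x)
  simp only [Function.comp, coordInv_coord, proj_mul_left hγ]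

lemma exists_left_mul_mem_target (y : ℝ × ℂ) : ∃ γ ∈ Γ, ∃ x₀ : LatticeQuotient Γ,
    coord (γ * coordInv y) ∈ (chartAt (ℝ × ℂ) x₀).target := by
  have h := mem_chart_target (ℝ × ℂ) (proj Γ (coordInv y))
  have h' := (chartAt (ℝ × ℂ) (proj Γ (coordInv y))).left_inv (mem_chart_source _ _)
  rw [chartAt_symm_eq] at h'
  obtain ⟨γ, hγ, e⟩ := proj_eq_proj.1 h'
  refine ⟨γ, hγ, proj Γ (coordInv y), ?_⟩
  rw [e, coord_coordInv]
  exact h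

lemma contDiff_pullCoord (α : SmoothOneForm (ℝ × ℂ) (LatticeQuotient Γ)) :
    ContDiff ℝ ∞ (pullCoord α) := by
  refine contDiff_iff_contDiffAt.2 fun y => ?_
  obtain ⟨γ, hγ, x₀, hx⟩ := exists_left_mul_mem_target (Γ := Γ) y
  have h1 : ContDiffAt ℝ ∞ (pullCoord α) (coord (γ * coordInv y)) := by
    rw [← inChart_eq_pullCoord α x₀]
    exact (α.contDiffOn_inChart x₀).contDiffAt ((chartAt (ℝ × ℂ) x₀).open_target.mem_nhds hx)
  have h2 : ContDiff ℝ ∞ (fderiv ℝ fun y => coord (γ * coordInv y)) :=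
    (contDiff_left_mul γ).fderiv_right (by simp)
  have h3 := (h1.comp y (contDiff_left_mul γ).contDiffAt).clm_comp h2.contDiffAt
  exact h3.congr_of_eventuallyEq (Filter.Eventually.of_forall (pullCoord_left_mul α hγ))

lemma fderiv_pullCoord_symm (α : closedOneForms (ℝ × ℂ) (LatticeQuotient Γ)) (y v w : ℝ × ℂ) :
    fderiv ℝ (pullCoord α.1) y v w = fderiv ℝ (pullCoord α.1) y w v := by
  obtain ⟨γ, hγ, x₀, hx⟩ := exists_left_mul_mem_target (Γ := Γ) y
  obtain ⟨r, hr, hb⟩ := Metric.isOpen_iff.1 (chartAt (ℝ × ℂ) x₀).open_target _ hx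
  have hd : Differentiable ℝ (pullCoord α.1) := (contDiff_pullCoord α.1).differentiable (by simp)
  -- On a ball in the target of a chart there is a primitive; its composition with the left
  -- translation by `γ` is a primitive near `y`.
  obtain ⟨g, hg⟩ := (convex_ball _ r).exists_forall_hasFDerivAt_of_fderiv_symmetric
    Metric.isOpen_ball hd.differentiableOn
    fun a ha v w => by
      have := α.2 x₀ a (hb ha) v w
      rwa [inChart_eq_pullCoord] at this
  have hτ := (contDiff_left_mul γ).differentiable (by simp)
  refine second_derivative_symmetric_of_eventually
    (f := fun y => g (coord (γ * coordInv y))) (f' := pullCoord α.1)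
    (f'' := fderiv ℝ (pullCoord α.1) y) ?_ (hd y).hasFDerivAt v w
  filter_upwards [hτ.continuous.continuousAt.preimage_mem_nhds (Metric.ball_mem_nhds _ hr)]
    with z hz
  rw [pullCoord_left_mul α.1 hγ z]
  exact (hg _ hz).comp z (hτ z).hasFDerivAt

lemma exists_hasFDerivAt_pullCoord (α : closedOneForms (ℝ × ℂ) (LatticeQuotient Γ)) :
    ∃ f : ℝ × ℂ → ℝ, ContDiff ℝ ∞ f ∧ ∀ y, HasFDerivAt f (pullCoord α.1 y) y := by
  obtain ⟨f, hf⟩ := convex_univ.exists_forall_hasFDerivAt_of_fderiv_symmetric isOpen_univ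
    ((contDiff_pullCoord α.1).differentiable (by simp)).differentiableOn
    fun a _ v w => fderiv_pullCoord_symm α a v w
  have hf' := fun y => hf y (Set.mem_univ y)
  refine ⟨f, contDiff_infty_iff_fderiv.2 ⟨fun y => (hf' y).differentiableAt, ?_⟩, hf'⟩
  rw [show fderiv ℝ f = pullCoord α.1 from funext fun y => (hf' y).fderiv]
  exact contDiff_pullCoord α.1

/-- The derivative of a primitive along a curve in the group. -/
lemma hasDerivAt_comp_of_pullCoord {α : SmoothOneForm (ℝ × ℂ) (LatticeQuotient Γ)}
    {f : ℝ × ℂ → ℝ} (hf : ∀ y, HasFDerivAt f (pullCoord α y) y) {c : ℝ → PSLTilde} {t : ℝ}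
    (hc : DifferentiableAt ℝ (fun t => coord (c t)) t) :
    HasDerivAt (fun t => f (coord (c t))) (α (proj Γ (c t))
      (mfderiv 𝓘(ℝ, ℝ) 𝓘(ℝ, ℝ × ℂ) (fun t => proj Γ (c t)) t (1 : ℝ))) t := by
  have aux : ∀ c : ℝ → ℝ × ℂ, DifferentiableAt ℝ c t →
      HasDerivAt (fun t => f (c t)) (α (proj Γ (coordInv (c t)))
        (mfderiv 𝓘(ℝ, ℝ) 𝓘(ℝ, ℝ × ℂ) (fun t => proj Γ (coordInv (c t))) t (1 : ℝ))) t := by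
    intro c hc
    have h1 := ((contMDiff_proj_coordInv Γ).mdifferentiable (by simp)
      (c t)).hasMFDerivAt.comp t hc.hasFDerivAt.hasMFDerivAt
    have e : mfderiv 𝓘(ℝ, ℝ) 𝓘(ℝ, ℝ × ℂ) (fun t => proj Γ (coordInv (c t))) t = _ := h1.mfderiv
    rw [e]
    exact ((hf (c t)).comp t hc.hasFDerivAt).hasDerivAt
  obtain ⟨c', rfl⟩ : ∃ c' : ℝ → ℝ × ℂ, c = fun t => coordInv (c' t) :=
    ⟨fun t => coord (c t), funext fun t => (coordInv_coord _).symm⟩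
  simp only [coord_coordInv] at hc ⊢
  exact aux c' hc

lemma contDiff_coord_mul_diagX (P : PSLTilde) : ContDiff ℝ ∞ fun t : ℝ => coord (P * diagX t) := by
  have h : (fun t => coord (P * diagX t)) =
      fun t : ℝ => coord (P * coordInv (0, -((t / 2 : ℝ) : ℂ))) := by
    funext t; rw [← coord_diagX, coordInv_coord]
  rw [h]
  exact (contDiff_left_mul P).comp (contDiff_const.prodMk
    (Complex.ofRealCLM.contDiff.comp (contDiff_id.div_const 2)).neg)

lemma velocity_flow_line (P : PSLTilde) (t : ℝ) :
    (velocity (fun t => proj Γ (P * diagX t)) t : ℝ × ℂ) =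
      velocity (fun s => flow Γ s (proj Γ (P * diagX t))) 0 := by
  have e : (fun s => proj Γ (P * diagX s)) =
      fun s => flow Γ (s - t) (proj Γ (P * diagX t)) := by
    funext s
    rw [flow_proj, mul_assoc, ← diagX_add, add_sub_cancel]
  rw [e]
  exact velocity_comp_sub_const
    ((contMDiff_flow_line Γ (proj Γ (P * diagX t))).mdifferentiable (by simp) 0) t

/-- A closed one-form on `M_Γ` has a primitive on the universal covering `G`; under `γ ∈ Γ` the
primitive changes by the period `a(γ)` of the class `a` of the form. -/
theorem exists_primitive (α : closedOneForms (ℝ × ℂ) (LatticeQuotient Γ)) :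
    ∃ F : PSLTilde → ℝ, ContMDiff 𝓘(ℝ, ℝ × ℂ) 𝓘(ℝ, ℝ) ∞ F ∧
      (∀ (γ : Γ) (P : PSLTilde), F (γ * P) = F P + eval Γ γ (DeRhamH1.mk _ _ α)) ∧
      ∀ (P : PSLTilde) (t : ℝ), HasDerivAt (fun t => F (P * diagX t))
        (α.1 (proj Γ (P * diagX t)) (generatorX Γ (proj Γ (P * diagX t)))) t := by
  obtain ⟨f, hf, hd⟩ := exists_hasFDerivAt_pullCoord α
  refine ⟨f ∘ coord, hf.contMDiff.comp contMDiff_coord, fun γ P => ?_, fun P t => ?_⟩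
  · have hev : eval Γ γ (DeRhamH1.mk _ _ α) = f (coord γ) - f (coord 1) := by
      rw [eval_mk, SmoothOneForm.lineIntegral, intervalIntegral.integral_eq_sub_of_hasDerivAt
        (f := fun t : ℝ => f (AffineMap.lineMap (coord 1) (coord γ) t))]
      · simp
      · intro t _
        have hl : Differentiable ℝ fun t : ℝ => AffineMap.lineMap (coord 1) (coord γ) t := by
          simp only [AffineMap.lineMap_apply_module]; fun_prop
        have h := hasDerivAt_comp_of_pullCoord hd (t := t)
          (c := fun t => coordInv (AffineMap.lineMap (coord 1) (coord γ) t))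
          (by simpa only [coord_coordInv] using hl t)
        simp only [coord_coordInv] at h
        exact h
      · exact (α.1.continuous_lineIntegrand (contMDiff_loop Γ γ)).intervalIntegrable _ _
    have hτ := (contDiff_left_mul (γ : PSLTilde)).differentiable (by simp)
    have hsub : ∀ y, HasFDerivAt (fun y => f (coord (γ * coordInv y)) - f y) 0 y := fun y => by
      have h := ((hd (coord (γ * coordInv y))).comp y (hτ y).hasFDerivAt).sub (hd y)
      rw [← pullCoord_left_mul α.1 γ.2 y, sub_self] at h
      exact h
    have hconst := is_const_of_fderiv_eq_zero (𝕜 := ℝ)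
      (fun y => (hsub y).differentiableAt) (fun y => (hsub y).fderiv) (coord P) (coord 1)
    simp only [coordInv_coord, mul_one] at hconst
    rw [hev]
    simp only [Function.comp]
    linarith
  · have h := hasDerivAt_comp_of_pullCoord hd
      (((contDiff_coord_mul_diagX P).differentiable (by simp)) t)
    exact h.congr_deriv (congrArg (fun v : ℝ × ℂ => α.1 (proj Γ (P * diagX t)) v)
      (velocity_flow_line P t))

end Primitive

end PSLTilde

/-! ### One-parameter subgroups, the Cartan decomposition, and perfectness of the group -/

namespace PSLTilde

section Subgroups

lemma ext_I {g h : PSLTilde} (hm : g.mat = h.mat)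
    (hl : g.log UpperHalfPlane.I = h.log UpperHalfPlane.I) : g = h :=
  coord_injective (Prod.ext (by simp only [coord, hm]) hl)

lemma matrix_congr {a b c d a' b' c' d' : ℝ} (ha : a = a') (hb : b = b') (hc : c = c')
    (hd : d = d') : !![a, b; c, d] = !![a', b'; c', d'] := by
  rw [ha, hb, hc, hd]

/-- The one-parameter group of (lifts of) rotations about `i`. -/
noncomputable def rot (θ : ℝ) : PSLTilde := coordInv (0, (θ : ℂ) * Complex.I)

/-- The one-parameter group of (lifts of) upper unipotent matrices. -/
noncomputable def upper (x : ℝ) : PSLTilde := coordInv (x, 0)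

lemma rot_mat (θ : ℝ) : ((rot θ).mat : Matrix (Fin 2) (Fin 2) ℝ) =
    !![Real.cos θ, -Real.sin θ; Real.sin θ, Real.cos θ] := by
  have h : Complex.normSq (Complex.exp (θ * Complex.I)) = 1 := by
    rw [Complex.normSq_eq_norm_sq, Complex.norm_exp_ofReal_mul_I, one_pow]
  simp [rot, coordInv_mat, coordInvMat, h, Complex.exp_ofReal_mul_I_re,
    Complex.exp_ofReal_mul_I_im]

lemma rot_log_I (θ : ℝ) : (rot θ).log UpperHalfPlane.I = θ * Complex.I := coordInv_log_I _

lemma rot_smul_I (θ : ℝ) : (rot θ).mat • UpperHalfPlane.I = UpperHalfPlane.I := by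
  have h : Complex.normSq (Complex.exp (θ * Complex.I)) = 1 := by
    rw [Complex.normSq_eq_norm_sq, Complex.norm_exp_ofReal_mul_I, one_pow]
  refine UpperHalfPlane.ext ?_
  rw [rot, coordInv_mat, coordInvMat_smul_I, h]
  simp

lemma upper_mat (x : ℝ) : ((upper x).mat : Matrix (Fin 2) (Fin 2) ℝ) = !![1, x; 0, 1] := by
  simp [upper, coordInv_mat, coordInvMat]

lemma upper_log (x : ℝ) (z : ℍ) : (upper x).log z = 0 := by
  simp [upper, coordInv_log, coordInvMat, ratio]

lemma diagX_mat (t : ℝ) : ((diagX t).mat : Matrix (Fin 2) (Fin 2) ℝ) =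
    !![Real.exp (t / 2), 0; 0, Real.exp (-(t / 2))] := rfl

lemma diagX_log (t : ℝ) (z : ℍ) : (diagX t).log z = -((t / 2 : ℝ) : ℂ) := rfl

lemma continuous_rot : Continuous rot :=
  coordHomeo.symm.continuous.comp (by fun_prop)

lemma rot_add (s t : ℝ) : rot (s + t) = rot s * rot t := by
  refine ext_I (Subtype.ext ?_) ?_
  · rw [mul_mat, Matrix.SpecialLinearGroup.coe_mul, rot_mat, rot_mat, rot_mat, Matrix.mul_fin_two,
      Real.cos_add, Real.sin_add]
    exact matrix_congr (by ring) (by ring) (by ring) (by ring)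
  · rw [mul_log, rot_smul_I, rot_log_I, rot_log_I, rot_log_I]
    push_cast; ring

lemma rot_zero : rot 0 = 1 := by
  have := rot_add 0 0
  simpa using this

lemma rot_neg (s : ℝ) : rot (-s) = (rot s)⁻¹ := by
  rw [eq_inv_iff_mul_eq_one, ← rot_add, neg_add_cancel, rot_zero]

lemma rot_nsmul (n : ℕ) (s : ℝ) : rot (n * s) = rot s ^ n := by
  induction n with
  | zero => simp [rot_zero]
  | succ n ih => rw [Nat.cast_succ, add_mul, one_mul, rot_add, ih, pow_succ]

lemma diagX_zero : diagX 0 = 1 := by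
  have := diagX_add 0 0
  simpa using this

lemma diagX_neg (s : ℝ) : diagX (-s) = (diagX s)⁻¹ := by
  rw [eq_inv_iff_mul_eq_one, ← diagX_add, neg_add_cancel, diagX_zero]

lemma upper_add (x y : ℝ) : upper (x + y) = upper x * upper y := by
  refine ext_I (Subtype.ext ?_) ?_
  · rw [mul_mat, Matrix.SpecialLinearGroup.coe_mul, upper_mat, upper_mat, upper_mat,
      Matrix.mul_fin_two]
    simp [add_comm]
  · simp [upper_log]

lemma diagX_mul_upper (t x : ℝ) : diagX t * upper x = upper (Real.exp t * x) * diagX t := by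
  refine ext_I (Subtype.ext ?_) ?_
  · rw [mul_mat, mul_mat, Matrix.SpecialLinearGroup.coe_mul, Matrix.SpecialLinearGroup.coe_mul,
      upper_mat, upper_mat, diagX_mat, Matrix.mul_fin_two, Matrix.mul_fin_two]
    have : Real.exp t * x * Real.exp (-(t / 2)) = Real.exp (t / 2) * x := by
      rw [mul_right_comm, ← Real.exp_add]; ring_nf
    simp [this]
  · simp [upper_log, diagX_log]

lemma diagX_smul_I (t : ℝ) : (((diagX t).mat • UpperHalfPlane.I : ℍ) : ℂ) =
    (Real.exp t : ℂ) * Complex.I := by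
  have h : (diagX t).mat = coordInvMat (0, -((t / 2 : ℝ) : ℂ)) := by
    rw [← coordInv_mat, ← coord_diagX, coordInv_coord]
  have h2 : Complex.normSq (Complex.exp (-((t / 2 : ℝ) : ℂ))) = Real.exp (-t) := by
    rw [Complex.normSq_eq_norm_sq, ← Complex.ofReal_neg, Complex.norm_exp_ofReal, sq,
      ← Real.exp_add]
    ring_nf
  rw [h, coordInvMat_smul_I, h2, Real.exp_neg, one_div, inv_inv, Complex.ofReal_zero, zero_add]

lemma dist_diagX_smul_I {t : ℝ} (ht : 0 ≤ t) :
    dist UpperHalfPlane.I ((diagX t).mat • UpperHalfPlane.I) = t := by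
  have h := diagX_smul_I t
  have hre : ((diagX t).mat • UpperHalfPlane.I : ℍ).re = 0 := by
    rw [← UpperHalfPlane.coe_re, h]; simp
  have him : ((diagX t).mat • UpperHalfPlane.I : ℍ).im = Real.exp t := by
    rw [← UpperHalfPlane.coe_im, h, Complex.im_ofReal_mul, Complex.I_im, mul_one]
  rw [UpperHalfPlane.dist_of_re_eq (by rw [hre]; simp), him]
  simp [Real.dist_eq, abs_of_nonneg ht]

/-- The rotation `rot (π / 2)` is a lift of the Weyl element `(0, -1; 1, 0)`, and its branch of
the logarithm is the principal one. -/
lemma rot_pi_div_two_log (z : ℍ) :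
    (rot (Real.pi / 2)).log z = (Real.pi / 2 : ℝ) * Complex.I + Complex.log (z / Complex.I) := by
  rw [log_eq, rot_log_I]
  have h10 : (rot (Real.pi / 2)).mat 1 0 = 1 := by
    have := congrFun (congrFun (rot_mat (Real.pi / 2)) 1) 0
    simpa using this
  have h11 : (rot (Real.pi / 2)).mat 1 1 = 0 := by
    have := congrFun (congrFun (rot_mat (Real.pi / 2)) 1) 1
    simpa using this
  rw [h10, h11]
  simp [ratio]

lemma rot_mul_diagX (t : ℝ) :
    rot (Real.pi / 2) * diagX t = diagX (-t) * rot (Real.pi / 2) := by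
  refine ext_I (Subtype.ext ?_) ?_
  · rw [mul_mat, mul_mat, Matrix.SpecialLinearGroup.coe_mul, Matrix.SpecialLinearGroup.coe_mul,
      rot_mat, diagX_mat, diagX_mat, Matrix.mul_fin_two, Matrix.mul_fin_two]
    simp [neg_div]
  · rw [mul_log, mul_log, rot_pi_div_two_log, rot_log_I, diagX_smul_I, diagX_log, diagX_log,
      mul_div_cancel_right₀ _ Complex.I_ne_zero, ← Complex.ofReal_log (Real.exp_pos t).le,
      Real.log_exp]
    push_cast; ring

/-- The Bruhat decomposition of a rotation by an angle in `(0, π)`. -/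
lemma rot_eq_bruhat {θ : ℝ} (h0 : 0 < θ) (hπ : θ < Real.pi) :
    rot θ = upper (Real.cos θ / Real.sin θ) * (rot (Real.pi / 2) *
      (diagX (2 * Real.log (Real.sin θ)) * upper (Real.cos θ / Real.sin θ))) := by
  have hs : 0 < Real.sin θ := Real.sin_pos_of_pos_of_lt_pi h0 hπ
  have hd : ((diagX (2 * Real.log (Real.sin θ))).mat : Matrix (Fin 2) (Fin 2) ℝ) =
      !![Real.sin θ, 0; 0, (Real.sin θ)⁻¹] := by
    rw [diagX_mat, mul_div_cancel_left₀ _ two_ne_zero, Real.exp_neg, Real.exp_log hs]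
  refine ext_I (Subtype.ext ?_) ?_
  · simp only [mul_mat, Matrix.SpecialLinearGroup.coe_mul, rot_mat, hd, upper_mat,
      Matrix.mul_fin_two, Real.cos_pi_div_two, Real.sin_pi_div_two]
    have hsq := Real.sin_sq_add_cos_sq θ
    refine matrix_congr ?_ ?_ ?_ ?_
    · field_simp; ring
    · field_simp; linear_combination -Real.sin θ * hsq
    · ring
    · field_simp; ring
  · have hz : ((((diagX (2 * Real.log (Real.sin θ))).mat *
        (upper (Real.cos θ / Real.sin θ)).mat) • UpperHalfPlane.I : ℍ) : ℂ) / Complex.I =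
        (Real.sin θ : ℂ) * Complex.exp (((θ - Real.pi / 2 : ℝ) : ℂ) * Complex.I) := by
      have e : ((((diagX (2 * Real.log (Real.sin θ))).mat *
        (upper (Real.cos θ / Real.sin θ)).mat : SL(2, ℝ)) : Matrix (Fin 2) (Fin 2) ℝ)) =
          !![Real.sin θ, Real.cos θ; 0, (Real.sin θ)⁻¹] := by
        rw [Matrix.SpecialLinearGroup.coe_mul, hd, upper_mat, Matrix.mul_fin_two]
        exact matrix_congr (by ring) (by field_simp; ring) (by ring) (by ring)
      have e' := fun i j => congrFun (congrFun e i) j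
      have hs' : (Real.sin θ : ℂ) ≠ 0 := by exact_mod_cast hs.ne'
      rw [UpperHalfPlane.coe_specialLinearGroup_apply]
      simp only [e', UpperHalfPlane.coe_I, Matrix.of_apply, Matrix.cons_val', Matrix.cons_val_zero,
        Matrix.cons_val_one, Matrix.cons_val_fin_one, Algebra.algebraMap_self, RingHom.id_apply]
      rw [Complex.exp_mul_I, ← Complex.ofReal_cos, ← Complex.ofReal_sin, Real.cos_sub_pi_div_two,
        Real.sin_sub_pi_div_two]
      push_cast at hs' ⊢
      field_simp
      linear_combination Complex.cos θ * Complex.I_sq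
    rw [mul_log, mul_log, mul_log, upper_log, upper_log, diagX_log, zero_add, add_zero, mul_mat,
      rot_pi_div_two_log, hz, Complex.log_ofReal_mul hs (Complex.exp_ne_zero _),
      Complex.log_exp (by rw [Complex.im_ofReal_mul, Complex.I_im]; linarith)
        (by rw [Complex.im_ofReal_mul, Complex.I_im]; linarith), rot_log_I]
    push_cast; ring

/-- The group is perfect: it has no non-trivial homomorphism to a commutative group. -/
theorem hom_eq_one {A : Type*} [CommGroup A] (φ : PSLTilde →* A) (g : PSLTilde) : φ g = 1 := by
  -- Conjugation by a diagonal element turns `upper x` into `upper (2 * x)`, its square.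
  have hupper : ∀ x, φ (upper x) = 1 := fun x => by
    have h := congrArg φ (diagX_mul_upper (Real.log 2) x)
    rw [Real.exp_log two_pos, two_mul, upper_add, map_mul, map_mul, map_mul, mul_comm] at h
    simpa using h
  -- Conjugation by the Weyl element inverts `diagX (t / 2)`, whose square is `diagX t`.
  have hdiag : ∀ t, φ (diagX t) = 1 := fun t => by
    have h := congrArg φ (rot_mul_diagX (t / 2))
    rw [map_mul, map_mul, mul_comm, mul_left_inj, diagX_neg, map_inv, eq_inv_iff_mul_eq_one,
      ← map_mul, ← diagX_add, add_halves] at h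
    exact h
  -- By the Bruhat decomposition all rotations by angles in `(0, π)` have the same image, which is
  -- therefore equal to its own square.
  have hconst : ∀ θ, 0 < θ → θ < Real.pi → φ (rot θ) = φ (rot (Real.pi / 2)) := fun θ h0 hπ => by
    have h := congrArg φ (rot_eq_bruhat h0 hπ)
    simpa [map_mul, hupper, hdiag] using h
  have hweyl : φ (rot (Real.pi / 2)) = 1 := by
    have h1 := hconst (Real.pi / 4) (by positivity) (by linarith [Real.pi_pos])
    have h2 := rot_add (Real.pi / 4) (Real.pi / 4)
    rw [show Real.pi / 4 + Real.pi / 4 = Real.pi / 2 by ring] at h2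
    have h3 := congrArg φ h2
    rw [map_mul, h1] at h3
    simpa using h3
  have hpos : ∀ θ, 0 ≤ θ → φ (rot θ) = 1 := fun θ h0 => by
    rcases h0.eq_or_lt with rfl | h0
    · rw [rot_zero, map_one]
    obtain ⟨n, hn⟩ := exists_nat_gt (θ / Real.pi)
    have hn0 : (0 : ℝ) < n := lt_of_le_of_lt (by positivity) hn
    have h := rot_nsmul n (θ / n)
    rw [mul_div_cancel₀ _ hn0.ne'] at h
    rw [h, map_pow, hconst _ (by positivity), hweyl, one_pow]
    rw [div_lt_iff₀ hn0]
    rwa [div_lt_iff₀ Real.pi_pos, mul_comm] at hn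
  have hrot : ∀ θ, φ (rot θ) = 1 := fun θ => by
    rcases le_total 0 θ with h | h
    · exact hpos θ h
    · have := hpos (-θ) (by linarith)
      rwa [rot_neg, map_inv, inv_eq_one] at this
  -- The Iwasawa decomposition.
  have hg : g = upper (coord g).1 * (diagX (-2 * (coord g).2.re) * rot (coord g).2.im) := by
    refine coord_injective (Prod.ext ?_ ?_)
    · have h : (((upper (coord g).1 * (diagX (-2 * (coord g).2.re) * rot (coord g).2.im)).mat •
          UpperHalfPlane.I : ℍ) : ℂ) = Real.exp (-2 * (coord g).2.re) * Complex.I +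
            (coord g).1 := by
        rw [mul_mat, mul_mat, mul_smul, mul_smul, rot_smul_I,
          UpperHalfPlane.coe_specialLinearGroup_apply]
        have e' := fun i j => congrFun (congrFun (upper_mat (coord g).1) i) j
        simp [e', diagX_smul_I]
      have h' := congrArg Complex.re h
      rw [Complex.add_re, Complex.re_ofReal_mul, Complex.I_re, mul_zero, zero_add,
        Complex.ofReal_re, UpperHalfPlane.coe_re] at h'
      exact h'.symm
    · change (coord g).2 = (upper (coord g).1 * (diagX (-2 * (coord g).2.re) *
        rot (coord g).2.im)).log UpperHalfPlane.I
      rw [mul_log, mul_log, upper_log, diagX_log, rot_log_I]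
      conv_lhs => rw [← Complex.re_add_im (coord g).2]
      push_cast; ring
  rw [hg, map_mul, map_mul, hupper, hdiag, hrot, one_mul, one_mul]

lemma eq_rot_of_smul_I {g : PSLTilde} (h : g.mat • UpperHalfPlane.I = UpperHalfPlane.I) :
    g = rot (g.log UpperHalfPlane.I).im := by
  have h1 := coordInvMat_smul_I (coord g)
  rw [← coordInv_mat, coordInv_coord, h] at h1
  have h2 := congrArg Complex.im h1
  have h3 : Complex.normSq (Complex.exp (coord g).2) = 1 := by
    simpa [eq_comm] using h2
  rw [Complex.normSq_eq_norm_sq, Complex.norm_exp, sq, ← Real.exp_add, Real.exp_eq_one_iff] at h3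
  have h4 : (coord g).2.re = 0 := by linarith
  refine coord_injective (Prod.ext ?_ ?_)
  · simp only [coord, h, rot_smul_I]
  · change (coord g).2 = (rot (coord g).2.im).log UpperHalfPlane.I
    rw [rot_log_I]
    exact Complex.ext (by simp [h4]) (by simp)

lemma rot_pi_div_two_smul (z : ℍ) :
    (((rot (Real.pi / 2)).mat • z : ℍ) : ℂ) = -(1 / (z : ℂ)) := by
  have e' := fun i j => congrFun (congrFun (rot_mat (Real.pi / 2)) i) j
  rw [UpperHalfPlane.coe_specialLinearGroup_apply]
  simp [e', neg_div]

lemma exists_rot_smul_re_eq_zero (z : ℍ) : ∃ θ, ((rot θ).mat • z : ℍ).re = 0 := by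
  have hc : Continuous fun θ : ℝ => ((rot θ).mat • z : ℍ).re := by
    have h := contDiff_smul (A := fun θ : ℝ => (rot θ).mat) (z := fun _ => z) (fun i j => ?_)
      contDiff_const
    · exact Complex.continuous_re.comp h.continuous
    · have e : (fun θ : ℝ => (rot θ).mat i j) =
          fun θ : ℝ => !![Real.cos θ, -Real.sin θ; Real.sin θ, Real.cos θ] i j := by
        funext θ; exact congrFun (congrFun (rot_mat θ) i) j
      rw [e]
      fin_cases i <;> fin_cases j
      · exact Real.contDiff_cos
      · exact Real.contDiff_sin.neg
      · exact Real.contDiff_sin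
      · exact Real.contDiff_cos
  -- The rotation by a right angle is `w ↦ -1 / w`, which changes the sign of the real part.
  have h1 : ((rot (Real.pi / 2)).mat • z : ℍ).re = -(z.re / Complex.normSq z) := by
    rw [← UpperHalfPlane.coe_re, rot_pi_div_two_smul]
    simp [Complex.inv_re]
  have h0 : ((rot 0).mat • z : ℍ).re = z.re := by rw [rot_zero, one_mat, one_smul]
  have hn : 0 < Complex.normSq (z : ℂ) := Complex.normSq_pos.2 (UpperHalfPlane.ne_zero z)
  rcases le_total 0 z.re with h | h
  · exact mem_range_of_exists_le_of_exists_ge hc ⟨Real.pi / 2, by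
      rw [h1]; have := div_nonneg h hn.le; linarith⟩ ⟨0, by rw [h0]; exact h⟩
  · exact mem_range_of_exists_le_of_exists_ge hc ⟨0, by rw [h0]; exact h⟩ ⟨Real.pi / 2, by
      rw [h1]; have := div_nonpos_of_nonpos_of_nonneg h hn.le; linarith⟩

lemma exists_rot_mul_diagX_smul_I (z : ℍ) :
    ∃ s t : ℝ, 0 ≤ t ∧ z = (rot s * diagX t).mat • UpperHalfPlane.I := by
  obtain ⟨θ, hθ⟩ := exists_rot_smul_re_eq_zero z
  set w := (rot θ).mat • z with hw
  have hz : z = (rot (-θ)).mat • w := by rw [hw, rot_neg, inv_mat, inv_smul_smul]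
  have hwI : (w : ℂ) = (Real.exp (Real.log w.im) : ℂ) * Complex.I := by
    rw [Real.exp_log w.im_pos]
    exact Complex.ext (by simp [hθ]) (by simp)
  rcases le_total 0 (Real.log w.im) with h | h
  · refine ⟨-θ, Real.log w.im, h, ?_⟩
    have : w = (diagX (Real.log w.im)).mat • UpperHalfPlane.I :=
      UpperHalfPlane.ext (by rw [diagX_smul_I, ← hwI])
    rw [hz, mul_mat, mul_smul, ← this]
  · refine ⟨-θ + Real.pi / 2, -Real.log w.im, by linarith, ?_⟩
    have : w = (rot (Real.pi / 2)).mat • (diagX (-Real.log w.im)).mat • UpperHalfPlane.I := by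
      refine UpperHalfPlane.ext ?_
      rw [rot_pi_div_two_smul, diagX_smul_I, hwI, Real.exp_neg]
      have := (Real.exp_pos (Real.log w.im)).ne'
      have h' : (Real.exp (Real.log w.im) : ℂ) ≠ 0 := by exact_mod_cast this
      push_cast at h' ⊢
      rw [one_div, mul_inv, inv_inv, Complex.inv_I]
      ring
    rw [mul_mat, rot_add, mul_mat, mul_smul, mul_smul, ← this, hz]

/-- The Cartan decomposition: the middle factor is the displacement of `i`. -/
theorem exists_cartan (g : PSLTilde) : ∃ s s' : ℝ,
    g = rot s * diagX (dist UpperHalfPlane.I (g.mat • UpperHalfPlane.I)) * rot s' := by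
  obtain ⟨s, t, ht, h⟩ := exists_rot_mul_diagX_smul_I (g.mat • UpperHalfPlane.I)
  have hd : dist UpperHalfPlane.I (g.mat • UpperHalfPlane.I) = t := by
    have hs : UpperHalfPlane.I = (rot s).mat • UpperHalfPlane.I := (rot_smul_I s).symm
    rw [h, mul_mat, mul_smul]
    nth_rewrite 1 [hs]
    rw [dist_smul, dist_diagX_smul_I ht]
  have hfix : ((rot s * diagX t)⁻¹ * g).mat • UpperHalfPlane.I = UpperHalfPlane.I := by
    rw [mul_mat, inv_mat, mul_smul, h, inv_smul_smul]
  exact ⟨s, _, by rw [hd, ← eq_rot_of_smul_I hfix, mul_inv_cancel_left]⟩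

end Subgroups

end PSLTilde

/-! ### The invariant mean on the compact quotient -/

namespace PSLTilde

section Averaging
open MeasureTheory
open scoped ENNReal

/-- A discrete subgroup with compact quotient has a compact set of representatives. -/
lemma exists_isCompact_cover (Γ : Subgroup PSLTilde) [DiscreteTopology Γ]
    [CompactSpace (LatticeQuotient Γ)] :
    ∃ C : Set PSLTilde, IsCompact C ∧ ∀ P, ∃ γ : Γ, (γ : PSLTilde) * P ∈ C := by
  have hopen : ∀ n : ℕ, IsOpen (proj Γ '' (coordInv '' Metric.ball 0 n)) := fun n =>
    (isLocalHomeomorph_proj Γ).isOpenMap _ (coordHomeo.symm.isOpenMap _ Metric.isOpen_ball)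
  obtain ⟨n, hn⟩ := (isCompact_univ (X := LatticeQuotient Γ)).elim_directed_cover _ hopen
    (fun p _ => by
      obtain ⟨P, rfl⟩ := Quotient.mk_surjective p
      obtain ⟨n, hn⟩ := exists_nat_gt ‖coord P‖
      exact Set.mem_iUnion.2 ⟨n, P, ⟨coord P, by simpa using hn, coordInv_coord P⟩, rfl⟩)
    (directed_of_isDirected_le fun m n hmn => Set.image_mono (Set.image_mono
      (Metric.ball_subset_ball (by exact_mod_cast hmn))))
  refine ⟨coordInv '' Metric.closedBall 0 n, (isCompact_closedBall _ _).image
    coordHomeo.symm.continuous, fun P => ?_⟩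
  obtain ⟨_, ⟨y, hy, rfl⟩, h⟩ := hn (Set.mem_univ (proj Γ P))
  obtain ⟨γ, hγ, e⟩ := proj_eq_proj.1 h
  exact ⟨⟨γ, hγ⟩, y, Metric.ball_subset_closedBall hy, e.symm⟩

lemma exists_bound_of_invariant (Γ : Subgroup PSLTilde) [DiscreteTopology Γ]
    [CompactSpace (LatticeQuotient Γ)] {h : PSLTilde → ℝ} (hc : Continuous h)
    (hi : ∀ (γ : Γ) P, h (γ * P) = h P) : ∃ B, ∀ P, |h P| ≤ B := by
  obtain ⟨C, hC, hcov⟩ := exists_isCompact_cover Γ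
  obtain ⟨B, hB⟩ := hC.exists_bound_of_continuousOn hc.continuousOn
  refine ⟨B, fun P => ?_⟩
  obtain ⟨γ, hγ⟩ := hcov P
  rw [← hi γ P]
  exact hB _ hγ

section General
variable {G : Type*} [Group G] {Γ : Subgroup G}

/-- A function whose translates under `Γ` sum up to one: the indicator function of a set of
representatives, divided by the number of representatives. -/
noncomputable def partitionDensity (Γ : Subgroup G) (C : Set G) (P : G) : ℝ≥0∞ :=
  C.indicator 1 P / ∑' γ : Γ, C.indicator 1 ((γ : G) * P)

lemma tsum_partitionDensity {C : Set G} (hcov : ∀ P, ∃ γ : Γ, (γ : G) * P ∈ C)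
    (hfin : ∀ P, {γ : Γ | (γ : G) * P ∈ C}.Finite) (P : G) :
    ∑' γ : Γ, partitionDensity Γ C ((γ : G) * P) = 1 := by
  have hS : ∀ δ : Γ, ∑' γ : Γ, C.indicator (1 : G → ℝ≥0∞) ((γ : G) * (δ * P)) =
      ∑' γ : Γ, C.indicator (1 : G → ℝ≥0∞) ((γ : G) * P) := fun δ => by
    rw [← (Equiv.mulRight δ).tsum_eq fun γ : Γ => C.indicator (1 : G → ℝ≥0∞) ((γ : G) * P)]
    simp [mul_assoc]
  simp only [partitionDensity, hS, div_eq_mul_inv]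
  rw [ENNReal.tsum_mul_right, ENNReal.mul_inv_cancel]
  · obtain ⟨γ, hγ⟩ := hcov P
    refine fun h => ?_
    have := ENNReal.tsum_eq_zero.1 h γ
    simp [hγ] at this
  · rw [tsum_eq_sum (s := (hfin P).toFinset) fun γ hγ => by
      rw [Set.Finite.mem_toFinset] at hγ
      exact Set.indicator_of_notMem (s := C) hγ (1 : G → ℝ≥0∞)]
    refine ENNReal.sum_ne_top.2 fun γ _ => ?_
    by_cases h : (γ : G) * P ∈ C <;> simp [h]

variable [MeasurableSpace G] [MeasurableMul G]

lemma measurable_partitionDensity [Countable Γ] {C : Set G} (hC : MeasurableSet C) :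
    Measurable (partitionDensity Γ C) := by
  have h1 : Measurable (C.indicator (1 : G → ℝ≥0∞)) := measurable_one.indicator hC
  exact h1.div (Measurable.tsum fun γ => h1.comp (measurable_const_mul _))

/-- The functional `h ↦ ∫ ψ h`, for `ψ` a density whose translates sum up to one, is invariant under
right translations on functions that are invariant under `Γ` on the left. -/
lemma lintegral_density_mul_right [Countable Γ] (μ : Measure G) [μ.IsMulLeftInvariant]
    [μ.IsMulRightInvariant] {ψ : G → ℝ≥0∞} (hψ : Measurable ψ)
    (hsum : ∀ P, ∑' γ : Γ, ψ ((γ : G) * P) = 1) {h : G → ℝ≥0∞} (hm : Measurable h)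
    (hi : ∀ (γ : Γ) P, h (γ * P) = h P) (g : G) :
    ∫⁻ P, ψ P * h (P * g) ∂μ = ∫⁻ P, ψ P * h P ∂μ := by
  have hψl : ∀ γ : G, Measurable fun P => ψ (γ * P) := fun γ => hψ.comp (measurable_const_mul _)
  have hψr : ∀ g : G, Measurable fun P => ψ (P * g) := fun g => hψ.comp (measurable_mul_const _)
  calc ∫⁻ P, ψ P * h (P * g) ∂μ
      = ∫⁻ P, ψ (P * g⁻¹) * h P ∂μ := by
        rw [← lintegral_mul_right_eq_self (fun P => ψ (P * g⁻¹) * h P) g]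
        simp only [mul_inv_cancel_right]
    _ = ∫⁻ P, ∑' γ : Γ, ψ (γ * P) * (ψ (P * g⁻¹) * h P) ∂μ := by
        refine lintegral_congr fun P => ?_
        rw [ENNReal.tsum_mul_right, hsum, one_mul]
    _ = ∑' γ : Γ, ∫⁻ P, ψ (γ * P) * (ψ (P * g⁻¹) * h P) ∂μ :=
        lintegral_tsum fun γ => ((hψl γ).mul ((hψr _).mul hm)).aemeasurable
    _ = ∑' γ : Γ, ∫⁻ P, ψ ((γ⁻¹ : Γ) * (P * g⁻¹)) * (ψ P * h P) ∂μ := by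
        refine tsum_congr fun γ => ?_
        rw [← lintegral_mul_left_eq_self
          (fun P => ψ ((γ⁻¹ : Γ) * (P * g⁻¹)) * (ψ P * h P)) (γ : G)]
        refine lintegral_congr fun P => ?_
        simp only [hi, InvMemClass.coe_inv, mul_assoc, inv_mul_cancel_left]
        ring
    _ = ∫⁻ P, ∑' γ : Γ, ψ ((γ⁻¹ : Γ) * (P * g⁻¹)) * (ψ P * h P) ∂μ := by
        refine (lintegral_tsum fun γ => ?_).symm
        exact (((hψl _).comp (measurable_mul_const _)).mul (hψ.mul hm)).aemeasurable
    _ = ∫⁻ P, ψ P * h P ∂μ := by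
        refine lintegral_congr fun P => ?_
        have e := (Equiv.inv Γ).tsum_eq fun γ : Γ => ψ (γ * (P * g⁻¹))
        simp only [Equiv.inv_apply] at e
        rw [ENNReal.tsum_mul_right, e, hsum, one_mul]

end General

lemma isMulRightInvariant_haar [MeasurableSpace PSLTilde] [BorelSpace PSLTilde]
    (μ : Measure PSLTilde) [μ.IsHaarMeasure] : μ.IsMulRightInvariant := by
  have : SecondCountableTopology PSLTilde := coordHomeo.isEmbedding.secondCountableTopology
  refine ⟨fun g => ?_⟩
  have h := Measure.isMulLeftInvariant_eq_smul (μ.map (· * g)) μ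
  have h1 := congrArg Units.val (hom_eq_one (Measure.modularCharacter (G := PSLTilde)).toHomUnits g)
  have h2 : Measure.modularCharacterFun g = 1 := h1
  rw [h, ← Measure.modularCharacterFun_eq_haarScalarFactor, h2, one_smul]

/-- The invariant mean on the compact quotient, as a measure on the group. -/
theorem exists_invariant_mean (Γ : Subgroup PSLTilde) [DiscreteTopology Γ]
    [CompactSpace (LatticeQuotient Γ)] [MeasurableSpace PSLTilde] [BorelSpace PSLTilde] :
    ∃ ν : Measure PSLTilde, IsFiniteMeasure ν ∧ ν ≠ 0 ∧
      ∀ h : PSLTilde → ℝ, Continuous h → (∀ (γ : Γ) P, h (γ * P) = h P) →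
        ∀ g, ∫ P, h (P * g) ∂ν = ∫ P, h P ∂ν := by
  have : SecondCountableTopology PSLTilde := coordHomeo.isEmbedding.secondCountableTopology
  have : Countable Γ := TopologicalSpace.separableSpace_iff_countable.1 inferInstance
  let μ : Measure PSLTilde := Measure.haar
  have : μ.IsMulRightInvariant := isMulRightInvariant_haar μ
  obtain ⟨C, hC, hcov⟩ := exists_isCompact_cover Γ
  have hfin : ∀ P, {γ : Γ | (γ : PSLTilde) * P ∈ C}.Finite := fun P => by
    refine (ProperlyDiscontinuousSMul.finite_disjoint_inter_image (Γ := Γ)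
      (isCompact_singleton (x := P)) hC).subset fun γ hγ => ?_
    exact ⟨(γ : PSLTilde) * P, ⟨P, rfl, rfl⟩, hγ⟩
  have hψ := measurable_partitionDensity (Γ := Γ) hC.measurableSet
  have hsum := tsum_partitionDensity hcov hfin
  set ψ := partitionDensity Γ C
  have hle : ∀ P, ψ P ≤ C.indicator 1 P := fun P => by
    refine ENNReal.div_le_of_le_mul ?_
    rw [mul_comm]
    by_cases hP : P ∈ C
    · refine le_mul_of_one_le_left (zero_le) ?_
      refine le_trans ?_ (ENNReal.le_tsum (1 : Γ))
      simp [hP]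
    · simp [hP]
  have hfinite : ∫⁻ P, ψ P ∂μ < ⊤ := by
    refine (lintegral_mono hle).trans_lt ?_
    rw [lintegral_indicator_one hC.measurableSet]
    exact hC.measure_lt_top
  refine ⟨μ.withDensity ψ, isFiniteMeasure_withDensity hfinite.ne, fun h0 => ?_,
    fun h hc hi g => ?_⟩
  · have h1 : ∫⁻ P, ψ P ∂μ = 0 := by
      rw [← setLIntegral_univ, ← withDensity_apply _ MeasurableSet.univ, h0]; rfl
    have h2 : ∫⁻ _ : PSLTilde, 1 ∂μ = 0 := by
      calc ∫⁻ _ : PSLTilde, 1 ∂μ = ∫⁻ P, ∑' γ : Γ, ψ (γ * P) ∂μ := by simp only [hsum]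
        _ = ∑' γ : Γ, ∫⁻ P, ψ (γ * P) ∂μ :=
          lintegral_tsum fun γ => (hψ.comp (measurable_const_mul _)).aemeasurable
        _ = 0 := by simp [lintegral_mul_left_eq_self, h1]
    rw [lintegral_one, Measure.measure_univ_eq_zero] at h2
    exact NeZero.ne μ h2
  · have : IsFiniteMeasure (μ.withDensity ψ) := isFiniteMeasure_withDensity hfinite.ne
    obtain ⟨B, hB⟩ := exists_bound_of_invariant Γ hc hi
    have key : ∀ k : PSLTilde → ℝ, Continuous k → (∀ P, 0 ≤ k P) →
        (∀ (γ : Γ) P, k (γ * P) = k P) →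
        ∫ P, k (P * g) ∂μ.withDensity ψ = ∫ P, k P ∂μ.withDensity ψ := by
      intro k hk h0 hki
      have hkg : Continuous fun P => k (P * g) := hk.comp (continuous_mul_const g)
      rw [integral_eq_lintegral_of_nonneg_ae (Filter.Eventually.of_forall fun P => h0 _)
        hkg.aestronglyMeasurable, integral_eq_lintegral_of_nonneg_ae
        (Filter.Eventually.of_forall h0) hk.aestronglyMeasurable]
      congr 1
      have hk' : Measurable fun P => ENNReal.ofReal (k P) := hk.measurable.ennreal_ofReal
      rw [lintegral_withDensity_eq_lintegral_mul _ hψ hk',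
        lintegral_withDensity_eq_lintegral_mul _ hψ (hkg.measurable.ennreal_ofReal)]
      exact lintegral_density_mul_right μ hψ hsum hk' (fun γ P => by rw [hki]) g
    have hint : ∀ k : PSLTilde → ℝ, Continuous k → (∀ P, |k P| ≤ B) →
        Integrable k (μ.withDensity ψ) := fun k hk hb =>
      Integrable.of_bound hk.aestronglyMeasurable B (Filter.Eventually.of_forall hb)
    have h3 := key (fun P => h P + B) (hc.add continuous_const)
      (fun P => by linarith [neg_abs_le (h P), hB P]) (fun γ P => by rw [hi])
    rw [integral_add (hint (fun P => h (P * g)) (hc.comp (continuous_mul_const g)) fun P => hB _)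
      (integrable_const _), integral_add (hint _ hc hB) (integrable_const _)] at h3
    exact add_right_cancel h3

/-- The mean of the increment of an equivariant function under a right translation vanishes: it is
a homomorphism from a perfect group to `ℝ`. -/
theorem exists_increment_mean_eq_zero (Γ : Subgroup PSLTilde) [DiscreteTopology Γ]
    [CompactSpace (LatticeQuotient Γ)] [MeasurableSpace PSLTilde] [BorelSpace PSLTilde]
    {F : PSLTilde → ℝ} {a : Γ → ℝ} (hF : Continuous F)
    (hi : ∀ (γ : Γ) P, F (γ * P) = F P + a γ) :
    ∃ ν : Measure PSLTilde, IsFiniteMeasure ν ∧ ν ≠ 0 ∧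
      ∀ g, Integrable (fun P => F (P * g) - F P) ν ∧ ∫ P, (F (P * g) - F P) ∂ν = 0 := by
  have : SecondCountableTopology PSLTilde := coordHomeo.isEmbedding.secondCountableTopology
  obtain ⟨ν, hν, h0, hinv⟩ := exists_invariant_mean Γ
  have hc : ∀ g, Continuous fun P => F (P * g) - F P := fun g =>
    (hF.comp (continuous_mul_const g)).sub hF
  have hI : ∀ g (γ : Γ) (P : PSLTilde), F (γ * P * g) - F (γ * P) = F (P * g) - F P :=
    fun g γ P => by rw [mul_assoc, hi, hi]; ring
  have hint : ∀ g, Integrable (fun P => F (P * g) - F P) ν := fun g => by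
    obtain ⟨B, hB⟩ := exists_bound_of_invariant Γ (hc g) (hI g)
    exact Integrable.of_bound (hc g).aestronglyMeasurable B (Filter.Eventually.of_forall hB)
  have hint' : ∀ g k, Integrable (fun P => F (P * g * k) - F (P * g)) ν := fun g k => by
    obtain ⟨B, hB⟩ := exists_bound_of_invariant Γ (hc k) (hI k)
    exact Integrable.of_bound ((hc k).comp (continuous_mul_const g)).aestronglyMeasurable B
      (Filter.Eventually.of_forall fun P => hB _)
  refine ⟨ν, hν, h0, fun g => ⟨hint g, ?_⟩⟩
  let φ : PSLTilde →* Multiplicative ℝ :=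
    { toFun := fun g => Multiplicative.ofAdd (∫ P, (F (P * g) - F P) ∂ν)
      map_one' := by simp
      map_mul' := fun g k => by
        rw [← ofAdd_add]
        congr 1
        have e : ∀ P, F (P * (g * k)) - F P =
            (F (P * g * k) - F (P * g)) + (F (P * g) - F P) := fun P => by
          rw [mul_assoc]; ring
        simp only [e]
        rw [integral_add (hint' g k) (hint g), hinv _ (hc k) (hI k) g, add_comm] }
  exact congrArg Multiplicative.toAdd (hom_eq_one φ g)

end Averaging

end PSLTilde

/-! ### Increments along flow lines and periods -/

namespace PSLTilde

section Bounds
open scoped Pointwise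

lemma translationLength_nonneg (P : PSLTilde) : 0 ≤ translationLength P :=
  Real.iInf_nonneg fun _ => dist_nonneg

lemma translationLength_le (P : PSLTilde) (z : ℍ) : translationLength P ≤ dist z (P.mat • z) :=
  ciInf_le ⟨0, by rintro _ ⟨z, rfl⟩; exact dist_nonneg⟩ z

lemma translationLength_inv (P : PSLTilde) : translationLength P⁻¹ = translationLength P := by
  refine iInf_congr fun z => ?_
  rw [inv_mat, ← dist_smul P.mat z, smul_inv_smul, dist_comm]

lemma dist_pow_smul_le (P : PSLTilde) (z : ℍ) (n : ℕ) :
    dist z ((P ^ n).mat • z) ≤ n * dist z (P.mat • z) := by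
  induction n with
  | zero => simp
  | succ n ih =>
    have h : dist ((P ^ n).mat • z) ((P ^ (n + 1)).mat • z) = dist z (P.mat • z) := by
      rw [pow_succ, mul_mat, mul_smul, dist_smul]
    have := dist_triangle z ((P ^ n).mat • z) ((P ^ (n + 1)).mat • z)
    push_cast
    linarith

lemma continuous_smul_I : Continuous fun g : PSLTilde => g.mat • UpperHalfPlane.I := by
  have h : Continuous fun g : PSLTilde => ((coordInvMat (coord g) • UpperHalfPlane.I : ℍ) : ℂ) :=
    contDiff_coordPoint.continuous.comp coordHomeo.continuous
  refine UpperHalfPlane.isEmbedding_coe.continuous_iff.2 ?_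
  simp only [← coordInv_mat, coordInv_coord] at h
  exact h

lemma continuous_diagX : Continuous diagX := by
  have h := (contDiff_coord_mul_diagX 1).continuous
  simp only [one_mul] at h
  have h' := coordHomeo.symm.continuous.comp h
  refine h'.congr fun t => coordInv_coord _

/-- The lifts of the rotations by multiples of `2 π` are central. -/
lemma rot_two_pi_comm (n : ℤ) (g : PSLTilde) :
    rot (n * (2 * Real.pi)) * g = g * rot (n * (2 * Real.pi)) := by
  have hm : (rot (n * (2 * Real.pi))).mat = 1 := by
    refine Subtype.ext ?_
    rw [rot_mat, Real.cos_int_mul_two_pi, ← zero_add ((n : ℝ) * (2 * Real.pi)),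
      Real.sin_add_int_mul_two_pi]
    simp [Matrix.one_fin_two]
  refine ext_I (by rw [mul_mat, mul_mat, hm, one_mul, mul_one]) ?_
  rw [mul_log, mul_log, log_eq (rot _), hm, one_smul]
  simp [ratio, add_comm]

variable {Γ : Subgroup PSLTilde} [DiscreteTopology Γ] [CompactSpace (LatticeQuotient Γ)]

variable (Γ) in
lemma exists_isCompact_connecting : ∃ Q : Set PSLTilde, IsCompact Q ∧
    ∀ P R : PSLTilde, ∃ γ : Γ, ∃ q ∈ Q, R = γ * P * q := by
  obtain ⟨C, hC, hcov⟩ := exists_isCompact_cover Γ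
  refine ⟨C⁻¹ * C, hC.inv.mul hC, fun P R => ?_⟩
  obtain ⟨γ, hγ⟩ := hcov P
  obtain ⟨δ, hδ⟩ := hcov R
  refine ⟨δ⁻¹ * γ, _, Set.mul_mem_mul (Set.inv_mem_inv.2 hγ) hδ, ?_⟩
  simp [mul_assoc]

variable {F : PSLTilde → ℝ} {a : Γ → ℝ}

lemma exists_increment_bound (hF : Continuous F) (hi : ∀ (γ : Γ) P, F (γ * P) = F P + a γ)
    {Q : Set PSLTilde} (hQ : IsCompact Q) : ∃ B, ∀ P, ∀ q ∈ Q, |F (P * q) - F P| ≤ B := by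
  obtain ⟨C, hC, hcov⟩ := exists_isCompact_cover Γ
  have hc : Continuous fun x : PSLTilde × PSLTilde => F (x.1 * x.2) - F x.1 := by fun_prop
  obtain ⟨B, hB⟩ := (hC.prod hQ).exists_bound_of_continuousOn hc.continuousOn
  refine ⟨B, fun P q hq => ?_⟩
  obtain ⟨γ, hγ⟩ := hcov P
  have h := hB (γ * P, q) ⟨hγ, hq⟩
  simp only [mul_assoc, hi, add_sub_add_right_eq_sub] at h
  exact h

/-- The increments under right translation by central elements are bounded, uniformly in the
central element: by centrality they oscillate by a uniformly bounded amount on `M_Γ`, and their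
mean vanishes. -/
theorem exists_increment_bound_central (hF : Continuous F)
    (hi : ∀ (γ : Γ) P, F (γ * P) = F P + a γ) :
    ∃ B, ∀ c : PSLTilde, (∀ g, c * g = g * c) → ∀ P, |F (P * c) - F P| ≤ B := by
  borelize PSLTilde
  obtain ⟨ν, hν, h0, hmean⟩ := exists_increment_mean_eq_zero Γ hF hi
  obtain ⟨Q, hQ, hconn⟩ := exists_isCompact_connecting Γ
  obtain ⟨B, hB⟩ := exists_increment_bound hF hi hQ
  -- Connect `P` to `R` by right translation by `q ∈ Q`, and move `c` past `q`.
  have hosc : ∀ c : PSLTilde, (∀ g, c * g = g * c) → ∀ P R,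
      |(F (R * c) - F R) - (F (P * c) - F P)| ≤ 2 * B := by
    intro c hc P R
    obtain ⟨γ, q, hq, rfl⟩ := hconn P R
    have h1 : F (γ * P * q * c) = F (P * c * q) + a γ := by
      rw [← hi]
      simp only [mul_assoc, hc q]
    have h2 : F (γ * P * q) = F (P * q) + a γ := by rw [← hi, mul_assoc]
    have h3 := abs_le.1 (hB (P * c) q hq)
    have h4 := abs_le.1 (hB P q hq)
    rw [h1, h2, abs_le]
    constructor <;> linarith
  refine ⟨2 * B, fun c hc P => abs_le.2 ⟨?_, ?_⟩⟩
  · obtain ⟨R, hR⟩ := MeasureTheory.exists_average_le h0 (hmean c).1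
    rw [MeasureTheory.average_eq, (hmean c).2, smul_zero] at hR
    have := abs_le.1 (hosc c hc P R)
    linarith
  · obtain ⟨R, hR⟩ := MeasureTheory.exists_le_average h0 (hmean c).1
    rw [MeasureTheory.average_eq, (hmean c).2, smul_zero] at hR
    have := abs_le.1 (hosc c hc P R)
    linarith

lemma exists_increment_bound_rot (hF : Continuous F)
    (hi : ∀ (γ : Γ) P, F (γ * P) = F P + a γ) : ∃ B, ∀ P θ, |F (P * rot θ) - F P| ≤ B := by
  obtain ⟨B₁, hB₁⟩ := exists_increment_bound_central hF hi
  obtain ⟨B₂, hB₂⟩ := exists_increment_bound hF hi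
    ((isCompact_Icc (a := 0) (b := 2 * Real.pi)).image continuous_rot)
  refine ⟨B₁ + B₂, fun P θ => ?_⟩
  have hpi : 0 < 2 * Real.pi := by positivity
  have hθ := toIcoMod_mem_Ico hpi 0 θ
  rw [zero_add] at hθ
  have e : rot θ = rot (toIcoMod hpi 0 θ) * rot (toIcoDiv hpi 0 θ * (2 * Real.pi)) := by
    rw [← rot_add, ← zsmul_eq_mul, toIcoMod_add_toIcoDiv_zsmul]
  have h1 := hB₁ _ (rot_two_pi_comm (toIcoDiv hpi 0 θ)) (P * rot (toIcoMod hpi 0 θ))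
  have h2 := hB₂ P _ ⟨_, ⟨hθ.1, hθ.2.le⟩, rfl⟩
  rw [mul_assoc, ← e] at h1
  rw [abs_le] at *
  constructor <;> linarith

/-- A lower bound for the increments along the flow lines gives, by the Cartan decomposition, a lower
bound for all increments in terms of the displacement of `i`. -/
lemma exists_increment_ge (hF : Continuous F) (hi : ∀ (γ : Γ) P, F (γ * P) = F P + a γ)
    {k B : ℝ} (hk : ∀ P t, 0 ≤ t → -(k * t) - B ≤ F (P * diagX t) - F P) :
    ∃ B', ∀ P g, -(k * dist UpperHalfPlane.I (g.mat • UpperHalfPlane.I)) - B' ≤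
      F (P * g) - F P := by
  obtain ⟨B₁, hB₁⟩ := exists_increment_bound_rot hF hi
  refine ⟨B + 2 * B₁, fun P g => ?_⟩
  obtain ⟨s, s', hg⟩ := exists_cartan g
  have h1 := abs_le.1 (hB₁ P s)
  have h2 := hk (P * rot s) _ (dist_nonneg (x := UpperHalfPlane.I)
    (y := g.mat • UpperHalfPlane.I))
  have h3 := abs_le.1 (hB₁ (P * rot s *
    diagX (dist UpperHalfPlane.I (g.mat • UpperHalfPlane.I))) s')
  have e : P * rot s * diagX (dist UpperHalfPlane.I (g.mat • UpperHalfPlane.I)) * rot s' =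
      P * g := by
    conv_rhs => rw [hg]
    simp only [mul_assoc]
  rw [e] at h3
  linarith

omit [DiscreteTopology Γ] [CompactSpace (LatticeQuotient Γ)] in
lemma apply_pow_mul (hi : ∀ (γ : Γ) P, F (γ * P) = F P + a γ) (γ : Γ) (n : ℕ) (P : PSLTilde) :
    F ((γ : PSLTilde) ^ n * P) = F P + n * a γ := by
  induction n with
  | zero => simp
  | succ n ih =>
    rw [pow_succ', mul_assoc, hi, ih]
    push_cast; ring

/-- A lower bound for the increments along the flow lines bounds the periods by the translation
length. The additive constant disappears when passing to powers of `γ`. -/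
theorem abs_period_le (hF : Continuous F) (hi : ∀ (γ : Γ) P, F (γ * P) = F P + a γ)
    {k B : ℝ} (hk0 : 0 ≤ k) (hk : ∀ P t, 0 ≤ t → -(k * t) - B ≤ F (P * diagX t) - F P) (γ : Γ) :
    |a γ| ≤ k * translationLength γ := by
  obtain ⟨B', hB'⟩ := exists_increment_ge hF hi hk
  have key : ∀ γ : Γ, -(a γ) ≤ k * translationLength γ := by
    intro γ
    rw [translationLength, Real.mul_iInf_of_nonneg hk0]
    refine le_ciInf fun z => ?_
    obtain ⟨P, hz⟩ : ∃ P : PSLTilde, z = P.mat • UpperHalfPlane.I :=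
      let ⟨_, _, _, h⟩ := exists_rot_mul_diagX_smul_I z
      ⟨_, h⟩
    have hn : ∀ n : ℕ, n * (-(a γ) - k * dist z ((γ : PSLTilde).mat • z)) ≤ B' := by
      intro n
      have h1 := hB' P (P⁻¹ * (γ : PSLTilde) ^ n * P)
      have h2 : dist UpperHalfPlane.I ((P⁻¹ * (γ : PSLTilde) ^ n * P).mat • UpperHalfPlane.I) =
          dist z (((γ : PSLTilde) ^ n).mat • z) := by
        rw [mul_mat, mul_mat, mul_smul, mul_smul, ← hz, ← dist_smul P.mat, ← hz, inv_mat,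
          smul_inv_smul]
      rw [h2, mul_assoc, mul_inv_cancel_left, apply_pow_mul hi] at h1
      have h3 := mul_le_mul_of_nonneg_left (dist_pow_smul_le γ z n) hk0
      linarith
    by_contra hcon
    obtain ⟨n, hn'⟩ := exists_nat_gt (B' / (-(a γ) - k * dist z ((γ : PSLTilde).mat • z)))
    rw [div_lt_iff₀ (by linarith)] at hn'
    exact absurd (hn n) (not_le.2 hn')
  have hinv : a γ⁻¹ = -(a γ) := by
    have h := hi γ⁻¹ ((γ : PSLTilde) * 1)
    rw [InvMemClass.coe_inv, inv_mul_cancel_left, hi] at h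
    linarith
  refine abs_le.2 ⟨by linarith [key γ], ?_⟩
  have h := key γ⁻¹
  rw [hinv, neg_neg, InvMemClass.coe_inv, translationLength_inv] at h
  exact h

/-- Along the flow the increments grow at most linearly, so some multiple of the translation length
bounds the periods. -/
lemma exists_abs_period_le (hF : Continuous F) (hi : ∀ (γ : Γ) P, F (γ * P) = F P + a γ) :
    ∃ k, 0 ≤ k ∧ ∀ γ : Γ, |a γ| ≤ k * translationLength γ := by
  obtain ⟨B, hB⟩ := exists_increment_bound hF hi
    ((isCompact_Icc (a := (0 : ℝ)) (b := 1)).image continuous_diagX)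
  have hB0 : 0 ≤ B := (abs_nonneg _).trans (hB 1 _ ⟨0, ⟨le_rfl, zero_le_one⟩, rfl⟩)
  have h : ∀ n : ℕ, ∀ (P : PSLTilde) (t : ℝ), 0 ≤ t → t ≤ n + 1 →
      -(B * (n + 1)) ≤ F (P * diagX t) - F P := by
    intro n
    induction n with
    | zero =>
      intro P t h0 h1
      have := abs_le.1 (hB P _ ⟨t, ⟨h0, by simpa using h1⟩, rfl⟩)
      simpa using this.1
    | succ n ih =>
      intro P t h0 h1
      rcases le_total t 1 with h | h
      · have := abs_le.1 (hB P _ ⟨t, ⟨h0, h⟩, rfl⟩)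
        push_cast
        nlinarith
      · have h2 := abs_le.1 (hB P _ ⟨1, ⟨zero_le_one, le_rfl⟩, rfl⟩)
        have h3 := ih (P * diagX 1) (t - 1) (by linarith) (by push_cast at h1; linarith)
        rw [mul_assoc, ← diagX_add, add_sub_cancel] at h3
        push_cast
        linarith
  refine ⟨B, hB0, abs_period_le (B := B) hF hi hB0 fun P t ht => ?_⟩
  have h1 := h ⌊t⌋₊ P t ht (Nat.lt_floor_add_one t).le
  have h2 := mul_le_mul_of_nonneg_left (Nat.floor_le ht) hB0
  linarith

/-- Conversely a bound for the periods bounds the increments along flow lines from below: the end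
of a flow line of length `T` differs by a bounded amount from the image of its beginning under some
`γ ∈ Γ`, whose translation length exceeds `T` by a bounded amount at most. -/
theorem exists_flow_increment_ge (hF : Continuous F) (hi : ∀ (γ : Γ) P, F (γ * P) = F P + a γ)
    {k : ℝ} (hk0 : 0 ≤ k) (hk : ∀ γ : Γ, |a γ| ≤ k * translationLength γ) :
    ∃ B, ∀ P t, 0 ≤ t → -(k * t) - B ≤ F (P * diagX t) - F P := by
  obtain ⟨Q, hQ, hconn⟩ := exists_isCompact_connecting Γ
  obtain ⟨B, hB⟩ := exists_increment_bound hF hi hQ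
  have hd : Continuous fun q : PSLTilde => dist UpperHalfPlane.I (q.mat • UpperHalfPlane.I) :=
    continuous_const.dist continuous_smul_I
  obtain ⟨D, hD⟩ := hQ.exists_bound_of_continuousOn hd.continuousOn
  refine ⟨B + k * D, fun P t ht => ?_⟩
  obtain ⟨γ, q, hq, e⟩ := hconn P (P * diagX t)
  have h1 : translationLength γ ≤ t + D := by
    refine (translationLength_le γ (P.mat • UpperHalfPlane.I)).trans ?_
    have e' : (γ : PSLTilde) * P = P * diagX t * q⁻¹ := by rw [e, mul_inv_cancel_right]
    have h2 : (γ : PSLTilde).mat • P.mat • UpperHalfPlane.I =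
        P.mat • (diagX t).mat • q⁻¹.mat • UpperHalfPlane.I := by
      rw [← mul_smul, ← mul_mat, e', mul_mat, mul_mat, mul_smul, mul_smul]
    rw [h2, dist_smul]
    refine (dist_triangle _ ((diagX t).mat • UpperHalfPlane.I) _).trans ?_
    rw [dist_diagX_smul_I ht, dist_smul, ← dist_smul q.mat, inv_mat, smul_inv_smul, dist_comm]
    have := hD q hq
    rw [Real.norm_of_nonneg dist_nonneg] at this
    linarith
  have h2 := mul_le_mul_of_nonneg_left h1 hk0
  have h3 := abs_le.1 (hB (γ * P) q hq)
  have h4 := abs_le.1 (hk γ)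
  rw [← e, hi] at h3
  linarith

end Bounds

end PSLTilde

/-! ### Averaging a one-form along the flow -/

section ParametricIntegral
open MeasureTheory
universe u
variable {H : Type u} [NormedAddCommGroup H] [NormedSpace ℝ H] [ProperSpace H]

lemma hasFDerivAt_intervalIntegral {V : Type*} [NormedAddCommGroup V] [NormedSpace ℝ V]
    {f : H × ℝ → V} (hf : ContDiff ℝ 1 f) (a b : ℝ) (x₀ : H) :
    HasFDerivAt (fun x => ∫ t in a..b, f (x, t))
      (∫ t in a..b, (fderiv ℝ f (x₀, t)).comp (ContinuousLinearMap.inl ℝ H ℝ)) x₀ := by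
  have hc : Continuous fun p : H × ℝ => (fderiv ℝ f p).comp (ContinuousLinearMap.inl ℝ H ℝ) :=
    (hf.continuous_fderiv (by simp)).clm_comp continuous_const
  obtain ⟨B, hB⟩ := ((isCompact_closedBall x₀ 1).prod
    (isCompact_uIcc (a := a) (b := b))).exists_bound_of_continuousOn hc.continuousOn
  have hft : ∀ x, Continuous fun t => f (x, t) := fun x => hf.continuous.comp (by fun_prop)
  refine intervalIntegral.hasFDerivAt_integral_of_dominated_of_fderiv_le (𝕜 := ℝ)
    (F := fun x t => f (x, t)) (bound := fun _ => B)
    (F' := fun x t => (fderiv ℝ f (x, t)).comp (ContinuousLinearMap.inl ℝ H ℝ))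
    (Metric.closedBall_mem_nhds x₀ one_pos)
    (Filter.Eventually.of_forall fun x => (hft x).aestronglyMeasurable)
    ((hft x₀).intervalIntegrable _ _)
    (Continuous.aestronglyMeasurable (hc.comp (by fun_prop)))
    (Filter.Eventually.of_forall fun t ht x hx => hB (x, t) ⟨hx, Set.uIoc_subset_uIcc ht⟩)
    intervalIntegrable_const (Filter.Eventually.of_forall fun t _ x _ => ?_)
  exact ((hf.differentiable (by simp)) (x, t)).hasFDerivAt.comp x (hasFDerivAt_prodMk_left x t)

lemma contDiff_intervalIntegral_nat (n : ℕ) (a b : ℝ) : ∀ {V : Type u} [NormedAddCommGroup V]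
    [NormedSpace ℝ V] {f : H × ℝ → V}, ContDiff ℝ n f →
      ContDiff ℝ n fun x => ∫ t in a..b, f (x, t) := by
  induction n with
  | zero =>
    intro V _ _ f hf
    refine contDiff_zero.2 ?_
    exact intervalIntegral.continuous_parametric_intervalIntegral_of_continuous'
      (f := fun x t => f (x, t)) hf.continuous a b
  | succ n ih =>
    intro V _ _ f hf
    have h1 := hasFDerivAt_intervalIntegral (hf.of_le (by norm_cast; omega)) a b
    have hf' : ContDiff ℝ n fun p : H × ℝ =>
        (fderiv ℝ f p).comp (ContinuousLinearMap.inl ℝ H ℝ) :=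
      (hf.fderiv_right (by norm_cast)).clm_comp contDiff_const
    rw [Nat.cast_succ, contDiff_succ_iff_fderiv]
    refine ⟨fun x => (h1 x).differentiableAt, fun h => absurd h (by simp), ?_⟩
    rw [funext fun x => (h1 x).fderiv]
    exact ih hf'

/-- Smoothness of an integral depending on a parameter. -/
theorem contDiff_intervalIntegral {V : Type u} [NormedAddCommGroup V] [NormedSpace ℝ V]
    {f : H × ℝ → V} (hf : ContDiff ℝ ∞ f) (a b : ℝ) :
    ContDiff ℝ ∞ fun x => ∫ t in a..b, f (x, t) :=
  contDiff_infty.2 fun n => contDiff_intervalIntegral_nat n a b (contDiff_infty.1 hf n)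

end ParametricIntegral

section Differential
variable {E : Type*} [NormedAddCommGroup E] [NormedSpace ℝ E]
  {M : Type*} [TopologicalSpace M] [ChartedSpace E M] [IsManifold 𝓘(ℝ, E) ∞ M]

/-- The differential of a smooth function, as a smooth one-form. -/
noncomputable def SmoothOneForm.differential (g : M → ℝ) (hg : ContMDiff 𝓘(ℝ, E) 𝓘(ℝ, ℝ) ∞ g) :
    SmoothOneForm E M where
  toFun x := mfderiv 𝓘(ℝ, E) 𝓘(ℝ, ℝ) g x
  contMDiff_toFun x₀ := by
    refine (contMDiffAt_hom_bundle _).2 ⟨contMDiffAt_id, ?_⟩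
    have h := ContMDiffAt.mfderiv_const (m := ∞) (hg x₀) (by simp)
    refine h.congr_of_eventuallyEq (Filter.Eventually.of_forall fun x => ?_)
    simp only [inTangentCoordinates, ContinuousLinearMap.inCoordinates]
    refine ContinuousLinearMap.ext fun v => ?_
    rw [TangentBundle.continuousLinearMapAt_model_space]
    exact DFunLike.congr_fun
      (Bundle.Trivial.continuousLinearMapAt_trivialization (𝕜 := ℝ) M ℝ x) _

lemma SmoothOneForm.differential_mem_exact (g : M → ℝ) (hg : ContMDiff 𝓘(ℝ, E) 𝓘(ℝ, ℝ) ∞ g) :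
    SmoothOneForm.differential g hg ∈ exactOneForms E M :=
  ⟨g, hg, fun _ _ => rfl⟩

omit [IsManifold 𝓘(ℝ, E) ∞ M] in
lemma hasDerivAt_comp_curve {g : M → ℝ} {c : ℝ → M} {x : M} {t : ℝ}
    (hg : MDifferentiableAt 𝓘(ℝ, E) 𝓘(ℝ, ℝ) g x)
    (hc : MDifferentiableAt 𝓘(ℝ, ℝ) 𝓘(ℝ, E) c t) (hx : c t = x) :
    HasDerivAt (fun t => g (c t))
      ((mfderiv 𝓘(ℝ, E) 𝓘(ℝ, ℝ) g x : E →L[ℝ] ℝ) (velocity (E := E) c t)) t := by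
  subst hx
  have h2 := (hasMFDerivAt_iff_hasFDerivAt (E := ℝ) (E' := ℝ)).1
    (hg.hasMFDerivAt.comp t hc.hasMFDerivAt)
  exact HasFDerivAt.hasDerivAt (𝕜 := ℝ) (F := ℝ) h2

end Differential

namespace PSLTilde

section AveragedForm
variable {Γ : Subgroup PSLTilde} [DiscreteTopology Γ]

/-- Smooth functions on `G` that are invariant under `Γ` descend to smooth functions on `M_Γ`. -/
lemma exists_descent {h : PSLTilde → ℝ} (hs : ContMDiff 𝓘(ℝ, ℝ × ℂ) 𝓘(ℝ, ℝ) ∞ h)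
    (hi : ∀ (γ : Γ) P, h (γ * P) = h P) : ∃ g : LatticeQuotient Γ → ℝ,
      ContMDiff 𝓘(ℝ, ℝ × ℂ) 𝓘(ℝ, ℝ) ∞ g ∧ ∀ P, g (proj Γ P) = h P := by
  refine ⟨Quotient.lift h fun P Q hPQ => ?_, fun x₀ => ?_, fun P => rfl⟩
  · obtain ⟨γ, rfl⟩ := hPQ
    exact hi γ Q
  · have h1 : ContMDiffAt 𝓘(ℝ, ℝ × ℂ) 𝓘(ℝ, ℝ × ℂ) ∞ (chartAt (ℝ × ℂ) x₀) x₀ :=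
      contMDiffAt_of_mem_maximalAtlas (IsManifold.chart_mem_maximalAtlas x₀)
        (mem_chart_source _ x₀)
    have h2 := (hs.comp contMDiff_coordInv).contMDiffAt.comp x₀ h1
    refine h2.congr_of_eventuallyEq ?_
    filter_upwards [(chartAt (ℝ × ℂ) x₀).open_source.mem_nhds (mem_chart_source _ x₀)] with x hx
    have h3 := (chartAt (ℝ × ℂ) x₀).left_inv hx
    rw [chartAt_symm_eq] at h3
    conv_lhs => rw [← h3]
    rfl

lemma contDiff_coord_mul_diagX_prod :
    ContDiff ℝ ∞ fun p : (ℝ × ℂ) × ℝ => coord (coordInv p.1 * diagX p.2) := by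
  have h : (fun p : (ℝ × ℂ) × ℝ => coord (coordInv p.1 * diagX p.2)) =
      fun p => coord (coordInv p.1 * coordInv (0, -((p.2 / 2 : ℝ) : ℂ))) := by
    funext p; rw [← coord_diagX, coordInv_coord]
  rw [h]
  have h' : ContDiff ℝ ∞ fun p : (ℝ × ℂ) × ℝ => (p.1, ((0 : ℝ), -((p.2 / 2 : ℝ) : ℂ))) :=
    contDiff_fst.prodMk (contDiff_const.prodMk
      (Complex.ofRealCLM.contDiff.comp (contDiff_snd.div_const 2)).neg)
  exact ContDiff.comp (f := fun p : (ℝ × ℂ) × ℝ => (p.1, ((0 : ℝ), -((p.2 / 2 : ℝ) : ℂ))))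
    contDiff_mul h'

/-- The average of a smooth function over flow lines of length `T` is smooth. -/
lemma contMDiff_flow_average {F : PSLTilde → ℝ} (hF : ContMDiff 𝓘(ℝ, ℝ × ℂ) 𝓘(ℝ, ℝ) ∞ F)
    (T : ℝ) :
    ContMDiff 𝓘(ℝ, ℝ × ℂ) 𝓘(ℝ, ℝ) ∞ fun P => T⁻¹ * ∫ s in (0 : ℝ)..T, F (P * diagX s) := by
  have h1 : ContDiff ℝ ∞ fun p : (ℝ × ℂ) × ℝ => F (coordInv p.1 * diagX p.2) := by
    have h := (hF.comp contMDiff_coordInv).contDiff.comp contDiff_coord_mul_diagX_prod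
    simpa only [Function.comp_def, coordInv_coord] using h
  have h2 : ContDiff ℝ ∞ fun y => T⁻¹ * ∫ s in (0 : ℝ)..T, F (coordInv y * diagX s) :=
    contDiff_const.mul (contDiff_intervalIntegral h1 0 T)
  refine (h2.contMDiff.comp contMDiff_coord).congr fun P => ?_
  simp only [Function.comp, coordInv_coord]

/-- Averaging a closed one-form along the flow during the time `T` yields a cohomologous form, whose
value on the generator of the flow is the mean increment of the primitive. -/
theorem exists_cohomologous (α : closedOneForms (ℝ × ℂ) (LatticeQuotient Γ)) {F : PSLTilde → ℝ}
    (hF : ContMDiff 𝓘(ℝ, ℝ × ℂ) 𝓘(ℝ, ℝ) ∞ F) {a : Γ → ℝ}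
    (hi : ∀ (γ : Γ) P, F (γ * P) = F P + a γ)
    (hd : ∀ (P : PSLTilde) (t : ℝ), HasDerivAt (fun t => F (P * diagX t))
      (α.1 (proj Γ (P * diagX t)) (generatorX Γ (proj Γ (P * diagX t)))) t)
    {T : ℝ} (hT : T ≠ 0) :
    ∃ β : closedOneForms (ℝ × ℂ) (LatticeQuotient Γ), DeRhamH1.mk _ _ β = DeRhamH1.mk _ _ α ∧
      ∀ P, (β.1 (proj Γ P) (generatorX Γ (proj Γ P)) : ℝ) = T⁻¹ * (F (P * diagX T) - F P) := by
  have hcont : ∀ P, Continuous fun s => F (P * diagX s) := fun P =>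
    continuous_iff_continuousAt.2 fun t => (hd P t).continuousAt
  obtain ⟨g, hg, hgP⟩ := exists_descent (Γ := Γ) ((contMDiff_flow_average hF T).sub hF)
    (fun γ P => by
      simp only [mul_assoc, hi]
      rw [intervalIntegral.integral_add ((hcont P).intervalIntegrable _ _)
        intervalIntegrable_const, intervalIntegral.integral_const, sub_zero, smul_eq_mul]
      field_simp
      ring)
  have hmem := SmoothOneForm.differential_mem_exact g hg
  refine ⟨α + ⟨_, exactOneForms_le_closedOneForms hmem⟩, ?_, fun P => ?_⟩
  · rw [map_add, add_eq_left]
    exact (Submodule.Quotient.mk_eq_zero _).2 hmem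
  · have h1 : HasDerivAt (fun t => g (flow Γ t (proj Γ P)))
        ((mfderiv 𝓘(ℝ, ℝ × ℂ) 𝓘(ℝ, ℝ) g (proj Γ P) : ℝ × ℂ →L[ℝ] ℝ)
          (velocity (E := ℝ × ℂ) (fun t => flow Γ t (proj Γ P)) 0)) 0 :=
      hasDerivAt_comp_curve (hg.mdifferentiable (by simp) _)
        ((contMDiff_flow_line Γ _).mdifferentiable (by simp) 0)
        (by rw [flow_proj, diagX_zero, mul_one])
    have h2 : HasDerivAt (fun t => T⁻¹ * (∫ s in t..(t + T), F (P * diagX s)) - F (P * diagX t))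
        (T⁻¹ * (F (P * diagX T) - F P) -
          α.1 (proj Γ P) (generatorX Γ (proj Γ P))) 0 := by
      have h3 : HasDerivAt (fun t => ∫ s in t..(t + T), F (P * diagX s))
          (F (P * diagX T) - F P) 0 := by
        have hp : ∀ t, HasDerivAt (fun u => ∫ s in (0 : ℝ)..u, F (P * diagX s))
            (F (P * diagX t)) t := fun t =>
          intervalIntegral.integral_hasDerivAt_right ((hcont P).intervalIntegrable _ _)
            (hcont P).aestronglyMeasurable.stronglyMeasurableAtFilter (hcont P).continuousAt
        have h4 := ((hp (0 + T)).comp_add_const 0 T).sub (hp 0)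
        rw [zero_add, diagX_zero, mul_one] at h4
        refine h4.congr_of_eventuallyEq (Filter.Eventually.of_forall fun t => ?_)
        exact (intervalIntegral.integral_interval_sub_left ((hcont P).intervalIntegrable _ _)
          ((hcont P).intervalIntegrable _ _)).symm
      have h5 := hd P 0
      rw [diagX_zero, mul_one] at h5
      exact (h3.const_mul T⁻¹).sub h5
    have h6 : (fun t => g (flow Γ t (proj Γ P))) =
        fun t => T⁻¹ * (∫ s in t..(t + T), F (P * diagX s)) - F (P * diagX t) := by
      funext t
      rw [flow_proj, hgP]
      simp only [mul_assoc, ← diagX_add]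
      rw [intervalIntegral.integral_comp_add_left (fun s => F (P * diagX s)), add_zero]
    rw [h6] at h1
    have h7 := h1.unique h2
    have h8 : ∀ x y z : ℝ, y = z - x → x + y = z := fun x y z h => by rw [h, add_sub_cancel]
    exact h8 (α.1 (proj Γ P) (generatorX Γ (proj Γ P))) _ _ h7

end AveragedForm

end PSLTilde

/-! ### The set of classes with small normalised periods -/

lemma neg_one_lt_iInf_coe_iff {ι : Type*} (u : ι → ℝ) :
    (-1 : EReal) < ⨅ i, (u i : EReal) ↔ ∃ c : ℝ, -1 < c ∧ ∀ i, c ≤ u i := by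
  rw [show (-1 : EReal) = ((-1 : ℝ) : EReal) by simp]
  constructor
  · intro h
    obtain ⟨c, hc1, hc⟩ := EReal.lt_iff_exists_real_btwn.1 h
    exact ⟨c, EReal.coe_lt_coe_iff.1 hc1, fun i => EReal.coe_le_coe_iff.1 (hc.le.trans (iInf_le _ i))⟩
  · rintro ⟨c, hc1, hc⟩
    refine lt_of_lt_of_le (b := (c : EReal)) (EReal.coe_lt_coe_iff.2 hc1)
      (le_iInf fun i => EReal.coe_le_coe_iff.2 (hc i))

lemma DeRhamH1.mk_surjective (E : Type*) [NormedAddCommGroup E] [NormedSpace ℝ E] (M : Type*)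
    [TopologicalSpace M] [ChartedSpace E M] [IsManifold 𝓘(ℝ, E) ∞ M] :
    Function.Surjective (DeRhamH1.mk E M) :=
  Submodule.mkQ_surjective _

namespace PSLTilde

section Periods
variable (Γ : Subgroup PSLTilde) [DiscreteTopology Γ] [CompactSpace (LatticeQuotient Γ)]

lemma exists_abs_eval_le (a : DeRhamH1 (ℝ × ℂ) (LatticeQuotient Γ)) :
    ∃ k, 0 ≤ k ∧ ∀ γ : Γ, |eval Γ γ a| ≤ k * translationLength γ := by
  obtain ⟨α, rfl⟩ := DeRhamH1.mk_surjective _ _ a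
  obtain ⟨F, hF, hi, -⟩ := exists_primitive α
  exact exists_abs_period_le hF.continuous hi

/-- The normalised periods `γ ↦ a(γ) / L(γ)` as a linear map into the bounded functions with the
supremum norm; `Δ_Γ` is the pull-back of the open unit ball. -/
noncomputable def normalisedPeriods : DeRhamH1 (ℝ × ℂ) (LatticeQuotient Γ) →ₗ[ℝ]
    BoundedContinuousFunction {γ : Γ // translationLength γ ≠ 0} ℝ where
  toFun a := BoundedContinuousFunction.ofNormedAddCommGroupDiscrete
    (fun γ => eval Γ γ a / translationLength (γ : Γ)) (exists_abs_eval_le Γ a).choose fun γ => by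
      have hL := (translationLength_nonneg (γ : Γ)).lt_of_ne γ.2.symm
      rw [Real.norm_eq_abs, abs_div, abs_of_pos hL, div_le_iff₀ hL]
      exact (exists_abs_eval_le Γ a).choose_spec.2 γ
  map_add' a b := by
    ext γ
    simp [add_div]
  map_smul' c a := by
    ext γ
    simp [mul_div_assoc]

lemma Delta_eq_preimage_ball : Delta Γ = normalisedPeriods Γ ⁻¹' Metric.ball 0 1 := by
  have habs : ∀ a (γ : {γ : Γ // translationLength γ ≠ 0}),
      |eval Γ γ a| / translationLength (γ : Γ) = ‖normalisedPeriods Γ a γ‖ := fun a γ => by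
    change _ = ‖eval Γ γ a / translationLength (γ : Γ)‖
    rw [Real.norm_eq_abs, abs_div, abs_of_nonneg (translationLength_nonneg _)]
  ext a
  rw [Set.mem_preimage, mem_ball_zero_iff]
  simp only [Delta, Set.mem_ofPred_eq, habs]
  constructor
  · intro h
    obtain ⟨k, hk, hk1⟩ := EReal.lt_iff_exists_real_btwn.1 h
    refine lt_of_le_of_lt ((BoundedContinuousFunction.norm_le (le_max_left 0 k)).2 fun γ => ?_)
      (max_lt one_pos (by exact_mod_cast hk1))
    have h1 := (le_iSup (fun γ : {γ : Γ // translationLength γ ≠ 0} =>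
      ((‖normalisedPeriods Γ a γ‖ : ℝ) : EReal)) γ).trans hk.le
    exact (EReal.coe_le_coe_iff.1 h1).trans (le_max_right _ _)
  · intro h
    refine lt_of_le_of_lt (iSup_le fun γ => EReal.coe_le_coe_iff.2
      (BoundedContinuousFunction.norm_coe_le_norm _ γ)) (?_ : _ < (1 : EReal))
    exact_mod_cast h

/-- Since `a(γ) = 0` for every `γ` with `L(γ) = 0`, the exceptional elements in the definition of
`Δ_Γ` need not be excluded. -/
lemma mem_Delta_iff (a : DeRhamH1 (ℝ × ℂ) (LatticeQuotient Γ)) : a ∈ Delta Γ ↔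
    ∃ k, 0 ≤ k ∧ k < 1 ∧ ∀ γ : Γ, |eval Γ γ a| ≤ k * translationLength γ := by
  rw [Delta_eq_preimage_ball, Set.mem_preimage, mem_ball_zero_iff]
  have hval : ∀ γ : {γ : Γ // translationLength γ ≠ 0}, ‖normalisedPeriods Γ a γ‖ =
      |eval Γ γ a| / translationLength (γ : Γ) := fun γ => by
    change ‖eval Γ γ a / translationLength (γ : Γ)‖ = _
    rw [Real.norm_eq_abs, abs_div, abs_of_nonneg (translationLength_nonneg _)]
  have hpos : ∀ γ : {γ : Γ // translationLength γ ≠ 0}, 0 < translationLength (γ : Γ) :=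
    fun γ => (translationLength_nonneg (γ : Γ)).lt_of_ne γ.2.symm
  constructor
  · intro h
    refine ⟨_, norm_nonneg _, h, fun γ => ?_⟩
    by_cases hγ : translationLength (γ : PSLTilde) = 0
    · obtain ⟨k, -, hk⟩ := exists_abs_eval_le Γ a
      have := hk γ
      rw [hγ, mul_zero] at this ⊢
      exact this
    · have := BoundedContinuousFunction.norm_coe_le_norm (normalisedPeriods Γ a) ⟨γ, hγ⟩
      rwa [hval, div_le_iff₀ (hpos ⟨γ, hγ⟩)] at this
  · rintro ⟨k, hk0, hk1, hk⟩
    refine lt_of_le_of_lt ((BoundedContinuousFunction.norm_le hk0).2 fun γ => ?_) hk1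
    rw [hval, div_le_iff₀ (hpos γ)]
    exact hk γ

lemma isOpen_Delta : IsOpen (Delta Γ) := by
  rw [Delta_eq_preimage_ball]
  have : IsModuleTopology ℝ (DeRhamH1 (ℝ × ℂ) (LatticeQuotient Γ)) := ⟨rfl⟩
  exact Metric.isOpen_ball.preimage (IsModuleTopology.continuous_of_linearMap _)

lemma convex_Delta : Convex ℝ (Delta Γ) := by
  rw [Delta_eq_preimage_ball]
  exact (convex_ball _ _).linear_preimage _

/-- A class in `Δ_Γ` is represented by a form that exceeds `-1` on the generator of the flow: the
average of any representative along the flow during a long time. -/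
lemma exists_form_of_mem_Delta {a : DeRhamH1 (ℝ × ℂ) (LatticeQuotient Γ)} (ha : a ∈ Delta Γ) :
    ∃ α : closedOneForms (ℝ × ℂ) (LatticeQuotient Γ), DeRhamH1.mk _ _ α = a ∧
      ∃ c : ℝ, -1 < c ∧ ∀ p, c ≤ α.1 p (generatorX Γ p) := by
  obtain ⟨k, hk0, hk1, hk⟩ := (mem_Delta_iff Γ a).1 ha
  obtain ⟨α, rfl⟩ := DeRhamH1.mk_surjective _ _ a
  obtain ⟨F, hF, hi, hd⟩ := exists_primitive α
  obtain ⟨B, hB⟩ := exists_flow_increment_ge hF.continuous hi hk0 hk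
  -- A time `T` with `B / T < (1 - k) / 2`.
  obtain ⟨T, hT, hTB⟩ : ∃ T : ℝ, 0 < T ∧ B ≤ T * ((1 - k) / 2) := by
    have h : 0 < (1 - k) / 2 := by linarith
    refine ⟨(|B| + 1) / ((1 - k) / 2), by positivity, ?_⟩
    rw [div_mul_cancel₀ _ h.ne']
    linarith [le_abs_self B]
  obtain ⟨β, hβ, hval⟩ := exists_cohomologous α hF hi hd hT.ne'
  refine ⟨β, hβ, -((1 + k) / 2), by linarith, fun p => ?_⟩
  obtain ⟨P, rfl⟩ : ∃ P, proj Γ P = p := Quotient.mk_surjective p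
  refine le_trans ?_ (hval P).ge
  rw [inv_mul_eq_div, le_div_iff₀ hT]
  linarith [hB P T hT.le]

/-- A lower bound for a form on the generator of the flow is a lower bound for the increments of
its primitive along flow lines, and hence bounds the periods. -/
lemma mk_mem_Delta {α : closedOneForms (ℝ × ℂ) (LatticeQuotient Γ)} {c : ℝ} (hc1 : -1 < c)
    (hc : ∀ p, c ≤ α.1 p (generatorX Γ p)) : DeRhamH1.mk _ _ α ∈ Delta Γ := by
  obtain ⟨F, hF, hi, hd⟩ := exists_primitive α
  refine (mem_Delta_iff Γ _).2 ⟨max 0 (-c), le_max_left _ _, max_lt one_pos (by linarith),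
    abs_period_le (B := 0) hF.continuous hi (le_max_left _ _) fun P t ht => ?_⟩
  have h1 := mul_sub_le_image_sub_of_le_deriv (f := fun t => F (P * diagX t)) (C := c)
    (fun t => (hd P t).differentiableAt) (fun t => by
      rw [(hd P t).deriv]
      exact hc _) ht
  simp only [diagX_zero, mul_one, sub_zero] at h1
  nlinarith [le_max_right 0 (-c)]

end Periods

end PSLTilde

/-- For a cocompact lattice `Γ` (a discrete subgroup with compact quotient `M_Γ`), the set `Δ_Γ` is a
non-empty, open and convex subset of `H¹(M_Γ, ℝ)`, and a class lies in `Δ_Γ` if and only if it is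
represented by a closed one-form whose values on `X_Γ` have infimum greater than `-1`. -/
theorem corollary3p11 (Γ : Subgroup PSLTilde) [DiscreteTopology Γ]
    [CompactSpace (PSLTilde.LatticeQuotient Γ)] :
    ((PSLTilde.Delta Γ).Nonempty ∧ IsOpen (PSLTilde.Delta Γ) ∧ Convex ℝ (PSLTilde.Delta Γ)) ∧
    ∀ a : DeRhamH1 (ℝ × ℂ) (PSLTilde.LatticeQuotient Γ),
      a ∈ PSLTilde.Delta Γ ↔
        ∃ α : closedOneForms (ℝ × ℂ) (PSLTilde.LatticeQuotient Γ),
          DeRhamH1.mk (ℝ × ℂ) (PSLTilde.LatticeQuotient Γ) α = a ∧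
          (-1 : EReal) < ⨅ p : PSLTilde.LatticeQuotient Γ,
            ((α.1 p (PSLTilde.generatorX Γ p) : ℝ) : EReal) := by
  refine ⟨⟨⟨0, (PSLTilde.mem_Delta_iff Γ 0).2 ⟨0, le_rfl, one_pos, fun γ => by simp⟩⟩,
    PSLTilde.isOpen_Delta Γ, PSLTilde.convex_Delta Γ⟩, fun a => ⟨fun ha => ?_, ?_⟩⟩
  · obtain ⟨α, hα, h⟩ := PSLTilde.exists_form_of_mem_Delta Γ ha
    exact ⟨α, hα, (neg_one_lt_iInf_coe_iff fun p => α.1 p (PSLTilde.generatorX Γ p)).2 h⟩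
  · rintro ⟨α, rfl, hα⟩
    obtain ⟨c, hc1, hc⟩ :=
      (neg_one_lt_iInf_coe_iff fun p => α.1 p (PSLTilde.generatorX Γ p)).1 hα
    exact PSLTilde.mk_mem_Delta Γ hc1 hc
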